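/- Let $\{x(n)\}_{n\in\mathbb{Z}}$ be a complex second-order random process ($E|x(n)|^2<\infty$) with autocorrelation $r_x(n,m)=E[x(n+m)x^*(n)]$, cyclostationary with period $P\ge 1$, i.e. $r_x(n+lP,m)=r_x(n,m)$ for all $l,n,m\in\mathbb{Z}$, and suppose $\sum_{m}|r_x(n,m)|<\infty$ for each $n$. Let $$S_X^{(k/P)}(f)=\frac1P\sum_{n=0}^{P-1}\sum_{m\in\mathbb{Z}} r_x(n,m)\,e^{-j2\pi(kn/P+fm)}\qquad(k\in\mathbb{Z},\ f\in\mathbb{R})$$ be its cyclic spectrum, and let the cyclic PSD matrix $\mathbf{S}_X(\sigma)\in\mathbb{C}^{P\times P}$, $\sigma\in[0,1/P)$, have entries $[\mathbf{S}_X(\sigma)]_{r,c}=S_X^{((r-c)/P)}(\sigma+\tfrac rP)$, $0\le r,c\le P-1$. Let $\phi(n,\lambda)$, $n\in\mathbb{Z}$, $\lambda\in[0,1)$, measurable in $\lambda$, be a Karhunen–Loève (KL) basis of the process with KL spectrum $\mathcal{S}(\lambda)$, that is: $\int_0^1\phi(n,\lambda)\phi^*(n',\lambda)\,d\lambda=\delta_{n-n'}$;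 $\sum_n\phi(n,\lambda)\phi^*(n,\lambda')=\delta(\lambda-\lambda')$ in the weak sense (when integrated over $A\times B$, for all measurable $A,B\subseteq[0,1)$); and $\sum_{l\in\mathbb{Z}} r_x(l,k-l)\phi(l,\lambda)=\mathcal{S}(\lambda)\phi(k,\lambda)$ for all $k\in\mathbb{Z}$ and $\lambda\in[0,1)$. Suppose it has the form proper to cyclostationary processes, $\phi(n,\sigma+\tfrac pP)=\sum_{q=0}^{P-1}b^{(p)}(q,\sigma)e^{j2\pi(\sigma+q/P)n}$ for $\sigma\in[0,1/P)$ and $0\le p\le P-1$. Write $\mathcal{S}^{(p)}(\sigma)=\mathcal{S}(\sigma+\tfrac pP)$. For measurable $A\subseteq[0,1)$ let $\xi(A)=\int_A d\xi(\lambda)$ be the mean-square limit of $\sum_{n=-M}^{M-1}x(n)\int_A\phi^*(n,\lambda)\,d\lambda$ as $M\to\infty$, and for measurable $A\subseteq[0,1/P)$ let $\widetilde{\mathbf{x}}(A)=[\xi(A),\xi(A+\tfrac1P),\dots,\xi(A+\tfrac{P-1}P)]^T$. Then: 1. The limits $\xi(A)$ exist, the functions $\mathcal{S}^{(p)}$ are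 integrable on $[0,1/P)$, and $E[\widetilde{\mathbf{x}}(\sigma)\widetilde{\mathbf{x}}^H(\sigma)]=\mathrm{Diag}(\mathcal{S}^{(0)}(\sigma),\dots,\mathcal{S}^{(P-1)}(\sigma))\,d\sigma$, in the sense that for all measurable $A,B\subseteq[0,1/P)$ $$E[\widetilde{\mathbf{x}}(A)\widetilde{\mathbf{x}}(B)^H]=\int_{A\cap B}\mathrm{Diag}\bigl(\mathcal{S}^{(0)}(\sigma),\dots,\mathcal{S}^{(P-1)}(\sigma)\bigr)\,d\sigma .$$ 2. The matrix $\mathbf{B}(\sigma)$ with columns $\mathbf{b}^{(p)}(\sigma)=[b^{(p)}(0,\sigma),\dots,b^{(p)}(P-1,\sigma)]^T$ is unitary for almost every $\sigma\in[0,1/P)$, and at every $\sigma\in[0,1/P)$ where it is unitary, $\mathcal{S}^{(0)}(\sigma),\dots,\mathcal{S}^{(P-1)}(\sigma)$ are the $P$ eigenvalues of $\mathbf{S}_X(\sigma)$, counted with multiplicity. 3. The average power $\lim_{N\to\infty}\frac1N\sum_{n=-N/2}^{N/2-1}E|x(n)|^2$ ($N$ even) exists and equals $$\int_0^{1/P}\mathrm{tr}\,\mathrm{Diag}\bigl(\mathcal{S}^{(0)}(\sigma),\dots,\mathcal{S}^{(P-1)}(\sigma)\bigr)\,d\sigma=\int_0^{1/P}\mathrm{tr}\,\mathbf{S}_X(\sigma)\,d\sigma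 .$$ The equality with $\int_0^{1/P}\mathrm{tr}\,\mathbf{S}_X(\sigma)\,d\sigma$ (where $\mathrm{tr}\,\mathbf{S}_X$ is integrable) needs no KL basis. -/

import Mathlib

open MeasureTheory Filter Topology Set
open scoped ComplexConjugate

/-- Autocorrelation `E[x(n+m) x*(n)]` at time `n` and lag `m`. -/
noncomputable def autocorr {Ω : Type*} [MeasurableSpace Ω] (μ : Measure Ω)
    (x : ℤ → Ω → ℂ) (n m : ℤ) : ℂ :=
  ∫ ω, x (n + m) ω * conj (x n ω) ∂μ

/-- The autocorrelation is periodic in time with period `P`. -/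
def IsCyclostationary {Ω : Type*} [MeasurableSpace Ω] (μ : Measure Ω)
    (x : ℤ → Ω → ℂ) (P : ℕ) : Prop :=
  ∀ n m l : ℤ, autocorr μ x n m = autocorr μ x (n + l * P) m

/-- Cyclic spectrum at cycle frequency `k / P` and frequency `f`. -/
noncomputable def cyclicSpectrum {Ω : Type*} [MeasurableSpace Ω] (μ : Measure Ω)
    (x : ℤ → Ω → ℂ) (P : ℕ) (k : ℤ) (f : ℝ) : ℂ :=
  (1 / (P : ℂ)) * ∑ n ∈ Finset.range P, ∑' m : ℤ,
    autocorr μ x n m *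
      Complex.exp (-(Complex.I * (2 * Real.pi * ((k : ℂ) * n / P + f * m))))

/-- Cyclic PSD matrix `[S_X(σ)]_{r,c} = S_X^{((r-c)/P)}(σ + r/P)`. -/
noncomputable def cyclicPSDMatrix {Ω : Type*} [MeasurableSpace Ω] (μ : Measure Ω)
    (x : ℤ → Ω → ℂ) (P : ℕ) (σ : ℝ) : Matrix (Fin P) (Fin P) ℂ :=
  Matrix.of fun r c => cyclicSpectrum μ x P ((r : ℤ) - (c : ℤ)) (σ + (r : ℝ) / P)

/-- `φ n t` (`t ∈ [0,1)`) is a Karhunen-Loève basis of the process, with KL spectrum `S`.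
The completeness relation `∑ₙ φ(n,t) φ*(n,t') = δ(t - t')` is an identity of distributions and
is written here integrated over `A × B`. -/
structure IsKLBasis {Ω : Type*} [MeasurableSpace Ω] (μ : Measure Ω)
    (x : ℤ → Ω → ℂ) (φ : ℤ → ℝ → ℂ) (S : ℝ → ℂ) : Prop where
  aestronglyMeasurable : ∀ n, AEStronglyMeasurable (φ n) (volume.restrict (Ico (0 : ℝ) 1))
  orthonormal : ∀ n n' : ℤ,
    ∫ t in Ico (0 : ℝ) 1, φ n t * conj (φ n' t) = if n = n' then 1 else 0
  complete : ∀ A B : Set ℝ, MeasurableSet A → MeasurableSet B →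
    A ⊆ Ico (0 : ℝ) 1 → B ⊆ Ico (0 : ℝ) 1 →
    HasSum (fun n : ℤ => (∫ t in A, φ n t) * ∫ t in B, conj (φ n t))
      ((volume.real (A ∩ B) : ℝ) : ℂ)
  eigenequation : ∀ t ∈ Ico (0 : ℝ) 1, ∀ k : ℤ,
    HasSum (fun l : ℤ => autocorr μ x l (k - l) * φ l t) (S t * φ k t)

/-- The cyclostationary form of the basis on the sub-bands `t = σ + p/P`, `σ ∈ [0,1/P)`:
`φ(n, σ + p/P) = ∑_q b^{(p)}(q,σ) e^{j2π(σ+q/P)n}`; here `b p q σ` is `b^{(p)}(q,σ)`. -/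
def HasCSForm (P : ℕ) (φ : ℤ → ℝ → ℂ) (b : Fin P → Fin P → ℝ → ℂ) : Prop :=
  ∀ p : Fin P, ∀ σ ∈ Ico (0 : ℝ) (1 / P), ∀ n : ℤ,
    φ n (σ + (p : ℝ) / P) =
      ∑ q : Fin P, b p q σ *
        Complex.exp (Complex.I * (2 * Real.pi * ((σ : ℂ) + (q : ℂ) / P) * n))

/-- The matrix `B_X(σ)`, whose columns are `b^{(0)}(σ), …, b^{(P-1)}(σ)`. -/
def basisMatrix (P : ℕ) (b : Fin P → Fin P → ℝ → ℂ) (σ : ℝ) : Matrix (Fin P) (Fin P) ℂ :=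
  Matrix.of fun q p => b p q σ

/-- The KL-PSD matrix: the diagonal matrix of the segmented KL spectrum
`S^{(p)}(σ) = S(σ + p/P)`. -/
noncomputable def klPSDMatrix (P : ℕ) (S : ℝ → ℂ) (σ : ℝ) : Matrix (Fin P) (Fin P) ℂ :=
  Matrix.diagonal fun p : Fin P => S (σ + (p : ℝ) / P)

/-- `ξ` is the KL transform of the process, as a random spectral set function:
`ξ(A) = ∫_A dξ` is the mean-square limit, as `M → ∞`, of
`∑_{n=-M}^{M-1} x(n) ∫_A φ*(n,t) dt`, for every measurable `A ⊆ [0,1)`. -/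
def IsKLTransform {Ω : Type*} [MeasurableSpace Ω] (μ : Measure Ω)
    (x : ℤ → Ω → ℂ) (φ : ℤ → ℝ → ℂ) (ξ : Set ℝ → Ω → ℂ) : Prop :=
  ∀ A : Set ℝ, MeasurableSet A → A ⊆ Ico (0 : ℝ) 1 →
    MemLp (ξ A) 2 μ ∧
    Tendsto (fun M : ℕ => eLpNorm (fun ω =>
        (∑ n ∈ Finset.Ico (-(M : ℤ)) (M : ℤ), x n ω * ∫ t in A, conj (φ n t)) - ξ A ω) 2 μ)
      atTop (𝓝 0)

/-- The vector of the increments of the `P` segmented KL spectral processes over a set `A` of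
values of `σ`: `p`-th entry `ξ^{(p)}(A) = ξ(A + p/P)`. -/
noncomputable def klVector {Ω : Type*} (P : ℕ) (ξ : Set ℝ → Ω → ℂ) (A : Set ℝ) (ω : Ω) :
    Fin P → ℂ :=
  fun p => ξ ((fun σ : ℝ => σ + (p : ℝ) / P) '' A) ω

/-- `p` is the average power `lim_N (1/N) ∑_{n=-N/2}^{N/2-1} E|x(n)|²`, with `N = 2M`. -/
def HasAveragePower {Ω : Type*} [MeasurableSpace Ω] (μ : Measure Ω)
    (x : ℤ → Ω → ℂ) (p : ℝ) : Prop :=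
  Tendsto (fun M : ℕ => (1 / (2 * (M : ℝ))) *
      ∑ n ∈ Finset.Ico (-(M : ℤ)) (M : ℤ), ∫ ω, ‖x n ω‖ ^ 2 ∂μ)
    atTop (𝓝 p)

/-!
On the sub-band `σ ∈ [0, 1/P)` a KL basis of cyclostationary form lies in the span of the `P`
exponentials `n ↦ e^{j2π(σ + q/P)n}`. Periodicity of the autocorrelation turns
`S_X(σ)` into the matrix, in these exponentials, of the operator `u ↦ ∑_l r_x(l, · - l) u(l)`, so
that the eigenequation reads `S_X(σ) B(σ) = B(σ) Diag(S^{(p)}(σ))`. The orthonormality relations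
are the Fourier coefficients over `[0, 1/P)` of the entries of the `P × P` Gram matrix of the basis
functions on `0, …, P - 1`; uniqueness of Fourier coefficients shows that this matrix is `P · 1`
almost everywhere, which makes `B(σ)` unitary. In particular the KL spectrum is bounded.

The completeness relation on `A × A` is Parseval's identity for the indicator of `A` and the
orthonormal system `φ(n, ·)`, so indicators expand in this system. By Schur's test the random
variables `x(n)` satisfy an upper Riesz bound, hence `ξ(A) = ∑_n x(n) ∫_A φ*(n, λ) dλ` converges
unconditionally in mean square. The eigenequation gives `E[x(k) ξ(B)*] = ∫_B S φ(k, ·)`, and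
expanding `ξ(A)` against this gives `E[ξ(A) ξ(B)*] = ∫_{A ∩ B} S`.

The average power of the process is the mean of `r_x(n, 0)` over a period, which is the integral
over `[0, 1)` of the cyclic spectrum at cycle frequency `0`; cutting `[0, 1)` into sub-bands turns
this into the integral of the trace of `S_X`.
-/

section FourierSeries

lemma norm_mul_fourier {T : ℝ} (c : ℂ) (w : ℤ) (t : AddCircle T) :
    ‖c * fourier w t‖ = ‖c‖ := by
  rw [norm_mul, fourier_apply, Circle.norm_coe, mul_one]

variable {T : ℝ} [hT : Fact (0 < T)]

lemma integral_Ico_fourier (w : ℤ) :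
    ∫ t in Ico 0 T, fourier w (t : AddCircle T) = if w = 0 then (T : ℂ) else 0 := by
  have hTC : (T : ℂ) ≠ 0 := mod_cast hT.out.ne'
  have h := fourierCoeff_eq_intervalIntegral (fourier (T := T) w) 0 0
  simp only [fourierCoeff_fourier, Pi.single_apply, neg_zero, fourier_zero, one_smul, zero_add,
    one_div, Complex.real_smul, Complex.ofReal_inv, eq_inv_mul_iff_mul_eq₀ hTC] at h
  rw [integral_Ico_eq_integral_Ioc, ← intervalIntegral.integral_of_le hT.out.le, ← h]
  simp [eq_comm]

lemma integral_Ico_tsum_mul_fourier_neg {c : ℤ → ℂ} (hc : Summable c) :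
    ∫ t in Ico 0 T, ∑' m, c m * fourier (-m) (t : AddCircle T) = T * c 0 := by
  have hint (m : ℤ) : IntegrableOn (fun t : ℝ ↦ c m * fourier (-m) (t : AddCircle T)) (Ico 0 T) :=
    ((continuous_const.mul ((fourier (-m)).continuous.comp
      (AddCircle.continuous_mk' T))).integrableOn_Icc).mono_set Ico_subset_Icc_self
  have hnorm : Summable fun m ↦ ∫ t in Ico 0 T, ‖c m * fourier (-m) (t : AddCircle T)‖ := by
    simpa only [norm_mul_fourier, setIntegral_const, smul_eq_mul] using hc.norm.mul_left _
  rw [← integral_tsum_of_summable_integral_norm hint hnorm]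
  simp only [integral_const_mul, integral_Ico_fourier, neg_eq_zero, mul_ite, mul_zero]
  rw [tsum_ite_eq, mul_comm]

variable {h : ℝ → ℂ}

lemma integrableOn_Ico_mul_continuousMap (hh : IntegrableOn h (Ico 0 T))
    (g : C(AddCircle T, ℂ)) : IntegrableOn (fun t ↦ h t * g (t : AddCircle T)) (Ico 0 T) :=
  hh.mul_bdd (c := ‖g‖)
    (g.continuous.comp (AddCircle.continuous_mk' T)).aestronglyMeasurable
    (.of_forall fun _ ↦ g.norm_coe_le_norm _)

/-- Integration against a function `h` that is integrable over the period `[0, T)`, as a continuous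
linear functional on the continuous functions on the circle; continuity is what allows passing from
the Fourier monomials to all continuous functions. -/
noncomputable def integralMulCLM (hh : IntegrableOn h (Ico 0 T)) : C(AddCircle T, ℂ) →L[ℂ] ℂ :=
  LinearMap.mkContinuous
    { toFun g := ∫ t in Ico 0 T, h t * g (t : AddCircle T)
      map_add' g₁ g₂ := by
        simp only [ContinuousMap.add_apply, mul_add]
        exact integral_add (integrableOn_Ico_mul_continuousMap hh g₁)
          (integrableOn_Ico_mul_continuousMap hh g₂)
      map_smul' c g := by
        simp [mul_left_comm, integral_const_mul] }
    (∫ t in Ico 0 T, ‖h t‖) fun g ↦ by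
      refine (norm_integral_le_integral_norm _).trans ?_
      rw [← integral_mul_const]
      refine integral_mono (integrableOn_Ico_mul_continuousMap hh g).norm (hh.norm.mul_const _)
        fun t ↦ ?_
      simp only [norm_mul]
      gcongr
      exact g.norm_coe_le_norm _

lemma integral_mul_continuousMap_eq_zero (hh : IntegrableOn h (Ico 0 T))
    (h0 : ∀ w : ℤ, ∫ t in Ico 0 T, h t * fourier w (t : AddCircle T) = 0)
    (g : C(AddCircle T, ℂ)) : ∫ t in Ico 0 T, h t * g (t : AddCircle T) = 0 := by
  have hle : (Submodule.span ℂ (range (fourier (T := T)))).topologicalClosure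
      ≤ LinearMap.ker (integralMulCLM hh).toLinearMap := by
    refine Submodule.topologicalClosure_minimal _ ?_ (integralMulCLM hh).isClosed_ker
    rw [Submodule.span_le]
    rintro _ ⟨w, rfl⟩
    exact h0 w
  rw [span_fourier_closure_eq_top, top_le_iff] at hle
  exact (hle ▸ Submodule.mem_top : g ∈ LinearMap.ker (integralMulCLM hh).toLinearMap)

lemma ae_eq_zero_of_forall_integral_mul_fourier_eq_zero (hh : IntegrableOn h (Ico 0 T))
    (h0 : ∀ w : ℤ, ∫ t in Ico 0 T, h t * fourier w (t : AddCircle T) = 0) :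
    ∀ᵐ t ∂volume.restrict (Ico 0 T), h t = 0 := by
  rw [← restrict_Ioo_eq_restrict_Ico, ae_restrict_iff' measurableSet_Ioo]
  refine isOpen_Ioo.ae_eq_zero_of_integral_contDiff_smul_eq_zero
    (hh.mono_set Ioo_subset_Ico_self).locallyIntegrableOn fun g hg _ hgs ↦ ?_
  have hvan : ∀ t ∉ Ioo 0 T, g t = 0 := fun t ht ↦
    image_eq_zero_of_notMem_tsupport fun h ↦ ht (hgs h)
  let G : C(AddCircle T, ℂ) :=
    ⟨AddCircle.liftIco T 0 fun t ↦ (g t : ℂ), AddCircle.liftIco_zero_continuous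
      (by simp [hvan 0 (by simp), hvan T (by simp)])
      (Complex.continuous_ofReal.comp hg.continuous).continuousOn⟩
  rw [← integral_mul_continuousMap_eq_zero hh h0 G,
    ← setIntegral_eq_integral_of_forall_compl_eq_zero (s := Ico 0 T) fun t ht ↦ by
      rw [hvan t fun h ↦ ht (Ioo_subset_Ico_self h), zero_smul]]
  refine setIntegral_congr_fun measurableSet_Ico fun t ht ↦ ?_
  simp only [G, ContinuousMap.coe_mk, Complex.real_smul]
  rw [AddCircle.liftIco_zero_coe_apply ht, mul_comm]

lemma ae_eq_const_of_forall_integral_mul_fourier (hh : IntegrableOn h (Ico 0 T)) {c : ℂ}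
    (hc : ∀ w : ℤ, ∫ t in Ico 0 T, h t * fourier w (t : AddCircle T) = if w = 0 then T * c else 0) :
    ∀ᵐ t ∂volume.restrict (Ico 0 T), h t = c := by
  have hconst : IntegrableOn (fun _ ↦ c) (Ico 0 T) := integrableOn_const (by simp)
  refine (ae_eq_zero_of_forall_integral_mul_fourier_eq_zero (hh.sub hconst) fun w ↦ ?_).mono
    fun t ↦ sub_eq_zero.1
  simp only [Pi.sub_apply, sub_mul]
  rw [integral_sub (integrableOn_Ico_mul_continuousMap hh _)
    (integrableOn_Ico_mul_continuousMap hconst _), hc, integral_const_mul, integral_Ico_fourier]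
  split_ifs <;> ring

end FourierSeries

section Subbands

variable {P : ℕ}

lemma image_add_div_Ico (p : Fin P) :
    (fun σ : ℝ ↦ σ + (p : ℝ) / P) '' Ico 0 (1 / P) = Ico ((p : ℝ) / P) ((p + 1 : ℝ) / P) := by
  rw [image_add_const_Ico, zero_add, ← add_div, add_comm]

lemma iUnion_Ico_div (P : ℕ) [NeZero P] :
    ⋃ p : Fin P, Ico ((p : ℝ) / P) ((p + 1 : ℝ) / P) = Ico 0 1 := by
  have hP : (0 : ℝ) < P := mod_cast NeZero.pos P
  ext t
  simp only [mem_iUnion, mem_Ico, div_le_iff₀ hP, lt_div_iff₀ hP]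
  constructor
  · rintro ⟨p, h0, h1⟩
    have hp : ((p : ℕ) : ℝ) + 1 ≤ P := mod_cast p.2
    constructor <;> by_contra! h <;> nlinarith [(p : ℕ).cast_nonneg (α := ℝ)]
  · rintro ⟨h0, h1⟩
    have htP : 0 ≤ t * P := by positivity
    exact ⟨⟨⌊t * P⌋₊, (Nat.floor_lt htP).2 (by nlinarith)⟩, Nat.floor_le htP,
      Nat.lt_floor_add_one _⟩

lemma pairwise_disjoint_Ico_div (P : ℕ) :
    Pairwise (Function.onFun Disjoint fun p : Fin P ↦ Ico ((p : ℝ) / P) ((p + 1 : ℝ) / P)) := by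
  intro p q hpq
  have hP : (0 : ℝ) < P := mod_cast p.pos
  refine Set.disjoint_left.2 fun t hp hq ↦ hpq (Fin.ext ?_)
  simp only [mem_Ico, div_le_iff₀ hP, lt_div_iff₀ hP] at hp hq
  have hpq_lt : ((p : ℕ) : ℝ) < (q : ℕ) + 1 := by linarith
  have hqp_lt : ((q : ℕ) : ℝ) < (p : ℕ) + 1 := by linarith
  norm_cast at hpq_lt hqp_lt
  lia

lemma image_add_div_subset {A : Set ℝ} (hA : A ⊆ Ico 0 (1 / P)) (p : Fin P) :
    (fun σ ↦ σ + (p : ℝ) / P) '' A ⊆ Ico 0 1 := by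
  have : NeZero P := ⟨p.pos.ne'⟩
  rw [← iUnion_Ico_div P]
  exact (image_mono hA).trans <| (image_add_div_Ico p).subset.trans
    (subset_iUnion (fun p : Fin P ↦ Ico ((p : ℝ) / P) ((p + 1 : ℝ) / P)) p)

lemma add_div_mem_Ico {σ : ℝ} (hσ : σ ∈ Ico (0 : ℝ) (1 / P)) (p : Fin P) :
    σ + (p : ℝ) / P ∈ Ico (0 : ℝ) 1 :=
  image_add_div_subset subset_rfl p (mem_image_of_mem _ hσ)

lemma disjoint_image_add_div {A B : Set ℝ} (hA : A ⊆ Ico 0 (1 / P)) (hB : B ⊆ Ico 0 (1 / P))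
    {p q : Fin P} (hpq : p ≠ q) :
    Disjoint ((fun σ ↦ σ + (p : ℝ) / P) '' A) ((fun σ ↦ σ + (q : ℝ) / P) '' B) := by
  have h := pairwise_disjoint_Ico_div P hpq
  simp only [Function.onFun, ← image_add_div_Ico] at h
  exact h.mono (image_mono hA) (image_mono hB)

lemma restrict_Ico_zero_one_eq_sum_map (P : ℕ) [NeZero P] :
    volume.restrict (Ico (0 : ℝ) 1) =
      ∑ p : Fin P, (volume.restrict (Ico (0 : ℝ) (1 / P))).map (fun σ ↦ σ + (p : ℝ) / P) := by
  rw [← iUnion_Ico_div P, Measure.restrict_iUnion (pairwise_disjoint_Ico_div P)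
    fun _ ↦ measurableSet_Ico, Measure.sum_fintype]
  refine Finset.sum_congr rfl fun p _ ↦ ?_
  rw [← image_add_div_Ico]
  exact ((measurePreserving_add_right volume ((p : ℝ) / P)).restrict_image_emb
    (measurableEmbedding_addRight _) _).map_eq.symm

variable [NeZero P] {E : Type*} [NormedAddCommGroup E]

lemma ae_restrict_Ico_zero_one_iff {Q : ℝ → Prop} :
    (∀ᵐ t ∂volume.restrict (Ico (0 : ℝ) 1), Q t) ↔
      ∀ p : Fin P, ∀ᵐ σ ∂volume.restrict (Ico (0 : ℝ) (1 / P)), Q (σ + (p : ℝ) / P) := by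
  simp only [restrict_Ico_zero_one_eq_sum_map P, ae_finsetSum_measure_iff, Finset.mem_univ,
    true_imp_iff, (measurableEmbedding_addRight _).ae_map_iff]

lemma aestronglyMeasurable_restrict_Ico_zero_one_iff {X : Type*} [TopologicalSpace X]
    [TopologicalSpace.PseudoMetrizableSpace X] {g : ℝ → X} :
    AEStronglyMeasurable g (volume.restrict (Ico (0 : ℝ) 1)) ↔
      ∀ p : Fin P, AEStronglyMeasurable (fun σ ↦ g (σ + (p : ℝ) / P))
        (volume.restrict (Ico (0 : ℝ) (1 / P))) := by
  simp only [restrict_Ico_zero_one_eq_sum_map P, ← Measure.sum_fintype,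
    aestronglyMeasurable_sum_measure_iff,
    (measurableEmbedding_addRight _).aestronglyMeasurable_map_iff, Function.comp_def]

lemma integrableOn_Ico_zero_one_iff {g : ℝ → E} :
    IntegrableOn g (Ico (0 : ℝ) 1) ↔
      ∀ p : Fin P, IntegrableOn (fun σ ↦ g (σ + (p : ℝ) / P)) (Ico (0 : ℝ) (1 / P)) := by
  simp only [IntegrableOn, restrict_Ico_zero_one_eq_sum_map P, integrable_finsetSum_measure,
    Finset.mem_univ, true_imp_iff, (measurableEmbedding_addRight _).integrable_map_iff,
    Function.comp_def]

lemma integral_Ico_zero_one_eq_integral_sum [NormedSpace ℝ E] {g : ℝ → E}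
    (hg : IntegrableOn g (Ico (0 : ℝ) 1)) :
    ∫ t in Ico (0 : ℝ) 1, g t =
      ∫ σ in Ico (0 : ℝ) (1 / P), ∑ p : Fin P, g (σ + (p : ℝ) / P) := by
  rw [integral_finsetSum _ fun p _ ↦ integrableOn_Ico_zero_one_iff.1 hg p]
  rw [IntegrableOn, restrict_Ico_zero_one_eq_sum_map P, integrable_finsetSum_measure] at hg
  rw [restrict_Ico_zero_one_eq_sum_map P, integral_finsetSum_measure hg]
  exact Finset.sum_congr rfl fun p _ ↦ (measurableEmbedding_addRight _).integral_map _

end Subbands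

section PeriodicSequences

variable {P : ℕ}

lemma sum_range_add_of_periodic {M : Type*} [AddCancelCommMonoid M] {a : ℤ → M}
    (ha : Function.Periodic a P) (m : ℤ) :
    ∑ n ∈ Finset.range P, a (n + m) = ∑ n ∈ Finset.range P, a n := by
  have hsucc (m : ℤ) :
      ∑ n ∈ Finset.range P, a (n + (m + 1)) = ∑ n ∈ Finset.range P, a (n + m) := by
    have h := Finset.sum_range_succ' (fun n : ℕ ↦ a (n + m)) P
    rw [Finset.sum_range_succ] at h
    simp only [add_comm (P : ℤ) m, ha m, Nat.cast_add, Nat.cast_one, Nat.cast_zero, zero_add,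
      add_left_inj] at h
    simp only [h, add_assoc, add_comm (1 : ℤ)]
  induction m using Int.induction_on with
  | zero => simp
  | succ i ih => rw [hsucc, ih]
  | pred i ih => rw [← ih, ← hsucc, sub_add_cancel]

lemma bddAbove_range_of_periodic [NeZero P] {a : ℤ → ℝ} (ha : Function.Periodic a P) :
    BddAbove (range a) := by
  rw [← ha.image_Ioc (mod_cast NeZero.pos P) 0]
  exact ((finite_Ioc _ _).image a).bddAbove

lemma sum_range_tsum_comm_of_periodic {M : Type*} [AddCommGroup M] [TopologicalSpace M]
    [ContinuousAdd M] [T2Space M] {g : ℤ → ℤ → M} (hg : ∀ m, Function.Periodic (g · m) P)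
    (h₁ : ∀ n, Summable (g n)) (h₂ : ∀ k, Summable fun l ↦ g l (k - l)) :
    ∑ n ∈ Finset.range P, ∑' m, g n m = ∑ k ∈ Finset.range P, ∑' l, g l (k - l) := by
  have h₂' (k : ℤ) : Summable fun m ↦ g (k - m) m :=
    ((Equiv.subLeft k).summable_iff.2 (h₂ k)).congr fun m ↦ by simp
  calc ∑ n ∈ Finset.range P, ∑' m, g n m
      = ∑' m, ∑ n ∈ Finset.range P, g n m := (Summable.tsum_finsetSum fun (n : ℕ) _ ↦ h₁ n).symm
    _ = ∑' m, ∑ n ∈ Finset.range P, g (n - m) m :=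
        tsum_congr fun m ↦ (sum_range_add_of_periodic (hg m) (-m)).symm
    _ = ∑ k ∈ Finset.range P, ∑' m, g (k - m) m :=
        Summable.tsum_finsetSum fun (k : ℕ) _ ↦ h₂' k
    _ = ∑ k ∈ Finset.range P, ∑' l, g l (k - l) := Finset.sum_congr rfl fun k _ ↦ by
        rw [← (Equiv.subLeft (k : ℤ)).tsum_eq]
        simp

lemma sum_Ico_neg_eq_sum_range {M : Type*} [AddCommMonoid M] (a : ℤ → M) (N : ℕ) :
    ∑ n ∈ Finset.Ico (-(N : ℤ)) N, a n = ∑ n ∈ Finset.range (2 * N), a (n - N) := by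
  have hN : ((N : ℤ) - -N).toNat = 2 * N := by lia
  simp only [Int.Ico_eq_finset_map, Finset.sum_map, hN]
  exact Finset.sum_congr rfl fun n _ ↦ congrArg a (neg_add_eq_sub _ _)

variable {E : Type*} [NormedAddCommGroup E]

lemma norm_sum_range_add_le_of_periodic [NeZero P] {a : ℤ → E} (ha : Function.Periodic a P)
    (h0 : ∑ n ∈ Finset.range P, a n = 0) (N : ℕ) (m : ℤ) :
    ‖∑ n ∈ Finset.range N, a (n + m)‖ ≤ ∑ n ∈ Finset.range P, ‖a n‖ := by
  have hper : Function.Periodic (fun N ↦ ∑ n ∈ Finset.range N, a (n + m)) P := fun N ↦ by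
    have h := sum_range_add_of_periodic ha (N + m)
    simp only [Finset.sum_range_add, Nat.cast_add]
    simp only [add_assoc, add_left_comm] at h ⊢
    rw [h, h0, add_zero]
  calc ‖∑ n ∈ Finset.range N, a (n + m)‖
      = ‖∑ n ∈ Finset.range (N % P), a (n + m)‖ := by rw [hper.map_mod_nat N]
    _ ≤ ∑ n ∈ Finset.range (N % P), ‖a (n + m)‖ := norm_sum_le _ _
    _ ≤ ∑ n ∈ Finset.range P, ‖a (n + m)‖ :=
        Finset.sum_le_sum_of_subset_of_nonneg
          (Finset.range_mono (Nat.mod_lt _ (NeZero.pos P)).le) fun _ _ _ ↦ norm_nonneg _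
    _ = ∑ n ∈ Finset.range P, ‖a n‖ := sum_range_add_of_periodic (ha.comp norm) m

lemma tendsto_average_Ico_of_periodic [NeZero P] [NormedSpace ℝ E] {a : ℤ → E}
    (ha : Function.Periodic a P) :
    Tendsto (fun N : ℕ ↦ (1 / (2 * (N : ℝ))) • ∑ n ∈ Finset.Ico (-(N : ℤ)) N, a n) atTop
      (𝓝 ((1 / (P : ℝ)) • ∑ n ∈ Finset.range P, a n)) := by
  have hP : (P : ℝ) ≠ 0 := NeZero.ne _
  set c := (1 / (P : ℝ)) • ∑ n ∈ Finset.range P, a n with hc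
  have hcenter : ∑ n ∈ Finset.range P, (a n - c) = 0 := by
    rw [Finset.sum_sub_distrib, Finset.sum_const, Finset.card_range, hc,
      ← Nat.cast_smul_eq_nsmul ℝ, smul_smul, mul_one_div_cancel hP, one_smul, sub_self]
  have hbdd (N : ℕ) : ‖∑ n ∈ Finset.range (2 * N), (a (n - N) - c)‖ ≤
      ∑ n ∈ Finset.range P, ‖a n - c‖ :=
    norm_sum_range_add_le_of_periodic (a := fun n ↦ a n - c) (fun n ↦ by simp only [ha n])
      hcenter _ (-N)
  have hinv : Tendsto (fun N : ℕ ↦ 1 / (2 * (N : ℝ))) atTop (𝓝 0) := by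
    simpa only [div_div] using tendsto_const_div_atTop_nhds_zero_nat (1 / 2 : ℝ)
  have hlim := (NormedField.tendsto_zero_smul_of_tendsto_zero_of_bounded hinv
    (isBoundedUnder_of ⟨_, hbdd⟩)).add_const c
  rw [zero_add] at hlim
  refine hlim.congr' ?_
  filter_upwards [eventually_gt_atTop 0] with N hN
  have hN' : 2 * (N : ℝ) ≠ 0 := by positivity
  rw [sum_Ico_neg_eq_sum_range, Pi.smul_apply', Finset.sum_sub_distrib, smul_sub, Finset.sum_const,
    Finset.card_range, ← Nat.cast_smul_eq_nsmul ℝ, smul_smul]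
  push_cast
  rw [one_div_mul_cancel hN', one_smul, sub_add_cancel]

end PeriodicSequences

section FourierModes

/-- The complex exponential `n ↦ e^{j2π(σ + q/P)n}`, in which a basis of cyclostationary form
expands; it is expressed through `fourier` so that the character laws of the circle apply. -/
noncomputable def fourierMode (P : ℕ) (σ : ℝ) (q : Fin P) (n : ℤ) : ℂ :=
  fourier n ((σ + (q : ℝ) / P : ℝ) : UnitAddCircle)

variable {P : ℕ}

lemma fourierMode_eq_exp (σ : ℝ) (q : Fin P) (n : ℤ) :
    fourierMode P σ q n =
      Complex.exp (Complex.I * (2 * Real.pi * ((σ : ℂ) + (q : ℂ) / P) * n)) := by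
  rw [fourierMode, fourier_coe_apply]
  push_cast
  congr 1
  ring

lemma fourierMode_neg (σ : ℝ) (q : Fin P) (n : ℤ) :
    fourierMode P σ q (-n) = conj (fourierMode P σ q n) :=
  fourier_neg

lemma norm_fourierMode (σ : ℝ) (q : Fin P) (n : ℤ) : ‖fourierMode P σ q n‖ = 1 := by
  rw [fourierMode, fourier_apply, Circle.norm_coe]

lemma continuous_fourierMode (q : Fin P) (n : ℤ) : Continuous fun σ ↦ fourierMode P σ q n :=
  (fourier n).continuous.comp
    ((AddCircle.continuous_mk' 1).comp (continuous_id.add continuous_const))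

lemma fourierMode_add_mul [NeZero P] (σ : ℝ) (q : Fin P) (n w : ℤ) :
    fourierMode P σ q (n + w * P) =
      fourier w (σ : AddCircle (1 / (P : ℝ))) * fourierMode P σ q n := by
  have hP : (P : ℂ) ≠ 0 := NeZero.ne _
  rw [fourierMode_eq_exp, fourierMode_eq_exp, fourier_coe_apply, ← Complex.exp_add,
    Complex.exp_eq_exp_iff_exists_int]
  refine ⟨q * w, ?_⟩
  push_cast
  field_simp
  ring

lemma natCast_zmod_injective : Function.Injective fun a : Fin P ↦ ((a : ℕ) : ZMod P) := by
  intro a c h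
  rwa [ZMod.natCast_eq_natCast_iff', Nat.mod_eq_of_lt a.2, Nat.mod_eq_of_lt c.2, Fin.val_inj] at h

lemma sum_conj_fourierMode_mul [NeZero P] (σ : ℝ) (r q : Fin P) :
    ∑ a : Fin P, conj (fourierMode P σ r a) * fourierMode P σ q a =
      if r = q then (P : ℂ) else 0 := by
  have hterm (a : Fin P) : conj (fourierMode P σ r a) * fourierMode P σ q a =
      ZMod.stdAddChar (((a : ℕ) : ZMod P) * (((q : ℕ) : ZMod P) - ((r : ℕ) : ZMod P))) := by
    have hcast : ((a : ℕ) : ZMod P) * (((q : ℕ) : ZMod P) - ((r : ℕ) : ZMod P)) =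
        ((a * (q - r) : ℤ) : ZMod P) := by push_cast; rfl
    rw [hcast, ZMod.stdAddChar_coe, ← fourierMode_neg, fourierMode_eq_exp, fourierMode_eq_exp,
      ← Complex.exp_add]
    congr 1
    push_cast
    ring
  have hbij : Function.Bijective fun a : Fin P ↦ ((a : ℕ) : ZMod P) :=
    (Fintype.bijective_iff_injective_and_card _).2 ⟨natCast_zmod_injective, by simp [ZMod.card]⟩
  rw [Fintype.sum_bijective _ hbij _
      (fun z ↦ ZMod.stdAddChar (z * (((q : ℕ) : ZMod P) - ((r : ℕ) : ZMod P)))) hterm,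
    AddChar.sum_mulShift _ (ZMod.isPrimitive_stdAddChar P), ZMod.card, Nat.cast_ite, Nat.cast_zero]
  simp only [sub_eq_zero, natCast_zmod_injective.eq_iff, eq_comm]

end FourierModes

section UnitaryDiagonalization

variable {n R : Type*} [Fintype n] [DecidableEq n] [CommRing R] [StarRing R] {A U : Matrix n n R}
  {d : n → R}

lemma eq_mul_diagonal_mul_star (hU : U ∈ Matrix.unitaryGroup n R)
    (h : A * U = U * Matrix.diagonal d) : A = U * Matrix.diagonal d * star U := by
  rw [← h, mul_assoc, Matrix.mem_unitaryGroup_iff.1 hU, mul_one]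

lemma star_mul_mul_eq_diagonal (hU : U ∈ Matrix.unitaryGroup n R)
    (h : A * U = U * Matrix.diagonal d) : star U * A * U = Matrix.diagonal d := by
  rw [mul_assoc, h, ← mul_assoc, Matrix.mem_unitaryGroup_iff'.1 hU, one_mul]

lemma roots_charpoly_of_mul_eq_mul_diagonal [IsDomain R]
    (hU : U ∈ Matrix.unitaryGroup n R) (h : A * U = U * Matrix.diagonal d) :
    A.charpoly.roots = Finset.univ.val.map d := by
  rw [eq_mul_diagonal_mul_star hU h, Matrix.charpoly_mul_comm, ← mul_assoc,
    Matrix.mem_unitaryGroup_iff'.1 hU, one_mul, Matrix.charpoly_diagonal,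
    ← Polynomial.roots_multiset_prod_X_sub_C (Finset.univ.val.map d), Multiset.map_map]
  rfl

lemma trace_eq_of_mul_eq_mul_diagonal (hU : U ∈ Matrix.unitaryGroup n R)
    (h : A * U = U * Matrix.diagonal d) : A.trace = (Matrix.diagonal d).trace := by
  rw [eq_mul_diagonal_mul_star hU h, Matrix.trace_mul_comm, ← mul_assoc,
    Matrix.mem_unitaryGroup_iff'.1 hU, one_mul]

open scoped Matrix.Norms.L2Operator in
lemma norm_le_of_mul_eq_mul_diagonal {𝕜 : Type*} [RCLike 𝕜] {A U : Matrix n n 𝕜} {d : n → 𝕜}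
    (hU : U ∈ Matrix.unitaryGroup n 𝕜) (h : A * U = U * Matrix.diagonal d) (i : n) :
    ‖d i‖ ≤ ‖A‖ :=
  calc ‖d i‖ ≤ ‖d‖ := norm_le_pi_norm d i
    _ = ‖U * Matrix.diagonal d‖ := by
      rw [CStarRing.norm_mem_unitary_mul _ hU, Matrix.l2_opNorm_diagonal]
    _ = ‖A‖ := by rw [← h, CStarRing.norm_mul_mem_unitary _ hU]

end UnitaryDiagonalization

section SampleMatrix

variable {P : ℕ} {ι : Type*}

/-- The matrix whose columns are the samples at `0, …, P - 1`, that is, over one period, of the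
sequences `u i`; sums over a period become products of such matrices. -/
def sampleMatrix (P : ℕ) (u : ι → ℤ → ℂ) : Matrix (Fin P) ι ℂ :=
  Matrix.of fun a i ↦ u i a

lemma conjTranspose_sampleMatrix_fourierMode_mul_self [NeZero P] (σ : ℝ) :
    (sampleMatrix P (fourierMode P σ)).conjTranspose * sampleMatrix P (fourierMode P σ) =
      (P : ℂ) • 1 := by
  ext r q
  simpa [Matrix.mul_apply, Matrix.one_apply, sampleMatrix] using sum_conj_fourierMode_mul σ r q

variable {φ : ℤ → ℝ → ℂ} {b : Fin P → Fin P → ℝ → ℂ} {σ : ℝ}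

/-- The basis functions of the `P` sub-bands at `σ`: the `p`-th one is `n ↦ φ(n, σ + p/P)`. -/
noncomputable def segmentedBasis (P : ℕ) (φ : ℤ → ℝ → ℂ) (σ : ℝ) (p : Fin P) (n : ℤ) : ℂ :=
  φ n (σ + (p : ℝ) / P)

lemma HasCSForm.segmentedBasis_eq_sum (hb : HasCSForm P φ b) (hσ : σ ∈ Ico (0 : ℝ) (1 / P))
    (p : Fin P) : segmentedBasis P φ σ p = ∑ q, b p q σ • fourierMode P σ q := by
  ext n
  simp only [segmentedBasis, hb p σ hσ, Finset.sum_apply, Pi.smul_apply, smul_eq_mul,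
    fourierMode_eq_exp]

lemma HasCSForm.segmentedBasis_add_mul [NeZero P] (hb : HasCSForm P φ b)
    (hσ : σ ∈ Ico (0 : ℝ) (1 / P)) (p : Fin P) (n w : ℤ) :
    segmentedBasis P φ σ p (n + w * P) =
      fourier w (σ : AddCircle (1 / (P : ℝ))) * segmentedBasis P φ σ p n := by
  simp only [hb.segmentedBasis_eq_sum hσ, Finset.sum_apply, Pi.smul_apply, smul_eq_mul,
    fourierMode_add_mul, Finset.mul_sum, mul_left_comm]

lemma HasCSForm.sampleMatrix_segmentedBasis (hb : HasCSForm P φ b)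
    (hσ : σ ∈ Ico (0 : ℝ) (1 / P)) :
    sampleMatrix P (segmentedBasis P φ σ) =
      sampleMatrix P (fourierMode P σ) * basisMatrix P b σ := by
  ext a p
  simp [sampleMatrix, basisMatrix, Matrix.mul_apply, hb.segmentedBasis_eq_sum hσ, mul_comm]

lemma HasCSForm.basisMatrix_eq [NeZero P] (hb : HasCSForm P φ b) (hσ : σ ∈ Ico (0 : ℝ) (1 / P)) :
    basisMatrix P b σ = (P : ℂ)⁻¹ •
      ((sampleMatrix P (fourierMode P σ)).conjTranspose *
        sampleMatrix P (segmentedBasis P φ σ)) := by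
  rw [hb.sampleMatrix_segmentedBasis hσ, ← mul_assoc,
    conjTranspose_sampleMatrix_fourierMode_mul_self, smul_mul_assoc, one_mul,
    inv_smul_smul₀ (NeZero.ne _)]

lemma HasCSForm.basisMatrix_mem_unitaryGroup [NeZero P] (hb : HasCSForm P φ b)
    (hσ : σ ∈ Ico (0 : ℝ) (1 / P))
    (h : sampleMatrix P (segmentedBasis P φ σ) *
      (sampleMatrix P (segmentedBasis P φ σ)).conjTranspose = (P : ℂ) • 1) :
    basisMatrix P b σ ∈ Matrix.unitaryGroup (Fin P) ℂ := by
  have hP : (P : ℂ) ≠ 0 := NeZero.ne _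
  rw [Matrix.mem_unitaryGroup_iff, Matrix.star_eq_conjTranspose, hb.basisMatrix_eq hσ,
    Matrix.conjTranspose_smul, Matrix.conjTranspose_mul, Matrix.conjTranspose_conjTranspose,
    smul_mul_smul_comm, mul_assoc, ← mul_assoc (sampleMatrix P (segmentedBasis P φ σ)), h,
    smul_mul_assoc, one_mul, mul_smul_comm, conjTranspose_sampleMatrix_fourierMode_mul_self,
    smul_smul, smul_smul]
  simp [hP]

end SampleMatrix

section Autocorrelation

variable {Ω : Type*} [MeasurableSpace Ω] {μ : Measure Ω} {x : ℤ → Ω → ℂ} {P : ℕ}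

lemma norm_autocorr_sub_comm (k l : ℤ) :
    ‖autocorr μ x l (k - l)‖ = ‖autocorr μ x k (l - k)‖ := by
  rw [autocorr, autocorr, ← RCLike.norm_conj, ← integral_conj]
  simp [mul_comm]

lemma summable_norm_autocorr_sub (hsum : ∀ n, Summable (autocorr μ x n)) (k : ℤ) :
    Summable fun l ↦ ‖autocorr μ x l (k - l)‖ := by
  simp only [norm_autocorr_sub_comm k]
  exact (hsum k).norm.comp_injective (sub_left_injective (b := k))

lemma IsCyclostationary.periodic (hcs : IsCyclostationary μ x P) (m : ℤ) :
    Function.Periodic (autocorr μ x · m) P := fun n ↦ by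
  simpa using (hcs n m 1).symm

/-- The autocorrelation operator on sequences, `u ↦ (k ↦ ∑_l r_x(l, k - l) u(l))`, of which the
functions of a Karhunen-Loève basis are eigenvectors. -/
noncomputable def autocorrOp (μ : Measure Ω) (x : ℤ → Ω → ℂ) (u : ℤ → ℂ) (k : ℤ) : ℂ :=
  ∑' l, autocorr μ x l (k - l) * u l

lemma summable_autocorr_mul_fourierMode (hsum : ∀ n, Summable (autocorr μ x n)) (σ : ℝ)
    (q : Fin P) (k : ℤ) : Summable fun l ↦ autocorr μ x l (k - l) * fourierMode P σ q l :=
  .of_norm <| by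
    simpa only [norm_mul, norm_fourierMode, mul_one] using summable_norm_autocorr_sub hsum k

lemma autocorrOp_sum_smul_fourierMode (hsum : ∀ n, Summable (autocorr μ x n)) (σ : ℝ)
    (c : Fin P → ℂ) (k : ℤ) :
    autocorrOp μ x (∑ q, c q • fourierMode P σ q) k =
      ∑ q, c q * autocorrOp μ x (fourierMode P σ q) k := by
  simp only [autocorrOp, ← tsum_mul_left]
  rw [← Summable.tsum_finsetSum fun q _ ↦
    (summable_autocorr_mul_fourierMode hsum σ q k).mul_left (c q)]
  simp only [Finset.sum_apply, Pi.smul_apply, smul_eq_mul, Finset.mul_sum, mul_left_comm]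

variable [NeZero P]

lemma periodic_conj_fourierMode_mul (σ : ℝ) (r c : Fin P) (m : ℤ) :
    Function.Periodic (fun n ↦ conj (fourierMode P σ r (n + m)) * fourierMode P σ c n) P := by
  intro n
  have hr := fourierMode_add_mul σ r (n + m) 1
  have hc := fourierMode_add_mul σ c n 1
  have hunit : conj (fourier 1 (σ : AddCircle (1 / (P : ℝ)))) *
      fourier 1 (σ : AddCircle (1 / (P : ℝ))) = (1 : ℂ) := by
    rw [← fourier_neg, ← fourier_add, neg_add_cancel, fourier_zero]
  rw [one_mul] at hr hc
  simp only
  rw [add_right_comm, hr, hc, map_mul, mul_mul_mul_comm, hunit, one_mul]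

lemma cyclicPSDMatrix_eq (hcs : IsCyclostationary μ x P)
    (hsum : ∀ n, Summable (autocorr μ x n)) (σ : ℝ) :
    cyclicPSDMatrix μ x P σ = (P : ℂ)⁻¹ • ((sampleMatrix P (fourierMode P σ)).conjTranspose *
      sampleMatrix P fun c ↦ autocorrOp μ x (fourierMode P σ c)) := by
  ext r c
  let g (n m : ℤ) : ℂ :=
    autocorr μ x n m * (conj (fourierMode P σ r (n + m)) * fourierMode P σ c n)
  have hper (m : ℤ) : Function.Periodic (g · m) P :=
    (hcs.periodic m).mul (periodic_conj_fourierMode_mul σ r c m)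
  have hnorm (n m : ℤ) : ‖g n m‖ = ‖autocorr μ x n m‖ := by simp [g, norm_fourierMode]
  have hterm (n : ℕ) (m : ℤ) : autocorr μ x n m * Complex.exp (-(Complex.I * (2 * Real.pi *
      ((((r : ℤ) - (c : ℤ) : ℤ) : ℂ) * n / P + ((σ + (r : ℝ) / P : ℝ) : ℂ) * m)))) = g n m := by
    simp only [g]
    rw [← fourierMode_neg, fourierMode_eq_exp, fourierMode_eq_exp, ← Complex.exp_add]
    congr 2
    push_cast
    ring
  calc cyclicPSDMatrix μ x P σ r c
      = (P : ℂ)⁻¹ * ∑ n ∈ Finset.range P, ∑' m, g n m := by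
        simp only [cyclicPSDMatrix, Matrix.of_apply, cyclicSpectrum, one_div, hterm]
    _ = (P : ℂ)⁻¹ * ∑ k ∈ Finset.range P, ∑' l, g l (k - l) := by
        rw [sum_range_tsum_comm_of_periodic hper
          (fun n ↦ .of_norm <| by simpa only [hnorm] using (hsum n).norm)
          (fun k ↦ .of_norm <| by simpa only [hnorm] using summable_norm_autocorr_sub hsum k)]
    _ = (P : ℂ)⁻¹ * ∑ k : Fin P, conj (fourierMode P σ r k) *
          autocorrOp μ x (fourierMode P σ c) k := by
        rw [Finset.sum_range]
        simp only [g, add_sub_cancel, autocorrOp, ← tsum_mul_left, mul_left_comm]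
    _ = _ := by simp [Matrix.mul_apply, sampleMatrix]

end Autocorrelation

section KLBasis

variable {Ω : Type*} [MeasurableSpace Ω] {μ : Measure Ω} {x : ℤ → Ω → ℂ} {P : ℕ}
  {φ : ℤ → ℝ → ℂ} {S : ℝ → ℂ} {b : Fin P → Fin P → ℝ → ℂ}

lemma IsKLBasis.autocorrOp_segmentedBasis (hφ : IsKLBasis μ x φ S) {σ : ℝ}
    (hσ : σ ∈ Ico (0 : ℝ) (1 / P)) (p : Fin P) :
    autocorrOp μ x (segmentedBasis P φ σ p) = S (σ + (p : ℝ) / P) • segmentedBasis P φ σ p :=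
  funext fun k ↦ (hφ.eigenequation _ (add_div_mem_Ico hσ p) k).tsum_eq

lemma IsKLBasis.cyclicPSDMatrix_mul_basisMatrix [NeZero P] (hφ : IsKLBasis μ x φ S)
    (hb : HasCSForm P φ b) (hcs : IsCyclostationary μ x P)
    (hsum : ∀ n, Summable (autocorr μ x n)) {σ : ℝ} (hσ : σ ∈ Ico (0 : ℝ) (1 / P)) :
    cyclicPSDMatrix μ x P σ * basisMatrix P b σ = basisMatrix P b σ * klPSDMatrix P S σ := by
  have hop : (sampleMatrix P fun c ↦ autocorrOp μ x (fourierMode P σ c)) * basisMatrix P b σ =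
      sampleMatrix P (segmentedBasis P φ σ) * klPSDMatrix P S σ := by
    ext a p
    have heig := congrFun (hφ.autocorrOp_segmentedBasis hσ p) a
    rw [hb.segmentedBasis_eq_sum hσ, autocorrOp_sum_smul_fourierMode hsum,
      ← hb.segmentedBasis_eq_sum hσ] at heig
    rw [klPSDMatrix, Matrix.mul_diagonal]
    simpa [Matrix.mul_apply, sampleMatrix, basisMatrix, mul_comm] using heig
  rw [cyclicPSDMatrix_eq hcs hsum, smul_mul_assoc, mul_assoc, hop, ← mul_assoc, ← smul_mul_assoc,
    ← hb.basisMatrix_eq hσ]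

lemma IsKLBasis.memLp (hφ : IsKLBasis μ x φ S) (n : ℤ) :
    MemLp (φ n) 2 (volume.restrict (Ico (0 : ℝ) 1)) := by
  rw [memLp_two_iff_integrable_sq_norm (hφ.aestronglyMeasurable n)]
  have hint : IntegrableOn (fun t ↦ φ n t * conj (φ n t)) (Ico 0 1) :=
    .of_integral_ne_zero (by simp [hφ.orthonormal])
  simpa [sq] using hint.norm

lemma IsKLBasis.integrableOn_mul_conj (hφ : IsKLBasis μ x φ S) (n n' : ℤ) :
    IntegrableOn (fun t ↦ φ n t * conj (φ n' t)) (Ico (0 : ℝ) 1) :=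
  (hφ.memLp n).integrable_mul (hφ.memLp n').star

lemma IsKLBasis.integral_sum_segmentedBasis_mul_conj [NeZero P] (hφ : IsKLBasis μ x φ S)
    (n n' : ℤ) :
    ∫ σ in Ico (0 : ℝ) (1 / P),
      ∑ p, segmentedBasis P φ σ p n * conj (segmentedBasis P φ σ p n') =
        if n = n' then 1 else 0 := by
  rw [← hφ.orthonormal,
    integral_Ico_zero_one_eq_integral_sum (P := P) (hφ.integrableOn_mul_conj n n')]
  rfl

lemma natCast_add_mul_eq_natCast_iff (a c : Fin P) (w : ℤ) :
    (a : ℤ) + w * P = c ↔ w = 0 ∧ a = c := by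
  refine ⟨fun h ↦ ?_, fun ⟨hw, hac⟩ ↦ by simp [hw, hac]⟩
  have hac : a = c := natCast_zmod_injective (by simpa using congrArg (Int.cast : ℤ → ZMod P) h)
  have hP : P ≠ 0 := a.pos.ne'
  exact ⟨by simpa [hac, hP] using h, hac⟩

/- For the entry `(a, c)`, the Fourier coefficient of index `w` of the function
`σ ↦ ∑_p φ(a, σ + p/P) φ*(c, σ + p/P)` is the inner product of `φ(a + wP, ·)` and `φ(c, ·)`. -/
lemma IsKLBasis.ae_sampleMatrix_mul_conjTranspose [NeZero P] (hφ : IsKLBasis μ x φ S)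
    (hb : HasCSForm P φ b) : ∀ᵐ σ ∂volume.restrict (Ico (0 : ℝ) (1 / P)),
      sampleMatrix P (segmentedBasis P φ σ) *
        (sampleMatrix P (segmentedBasis P φ σ)).conjTranspose = (P : ℂ) • 1 := by
  have hP : (P : ℂ) ≠ 0 := NeZero.ne _
  have : Fact ((0 : ℝ) < 1 / P) := ⟨one_div_pos.2 (mod_cast NeZero.pos P)⟩
  simp only [← Matrix.ext_iff, ae_all_iff]
  intro a c
  have hint : IntegrableOn (fun σ ↦ ∑ p, segmentedBasis P φ σ p a *
      conj (segmentedBasis P φ σ p c)) (Ico (0 : ℝ) (1 / P)) := by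
    have hprod := (integrableOn_Ico_zero_one_iff (P := P)).1 (hφ.integrableOn_mul_conj a c)
    exact integrable_finsetSum _ fun p _ ↦ hprod p
  have hcoeff (w : ℤ) : ∫ σ in Ico (0 : ℝ) (1 / P), (∑ p, segmentedBasis P φ σ p a *
      conj (segmentedBasis P φ σ p c)) * fourier w (σ : AddCircle (1 / (P : ℝ))) =
        if w = 0 then ((1 / (P : ℝ) : ℝ) : ℂ) * (if a = c then (P : ℂ) else 0) else 0 := by
    have hshift : ∀ σ ∈ Ico (0 : ℝ) (1 / P), (∑ p, segmentedBasis P φ σ p a *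
        conj (segmentedBasis P φ σ p c)) * fourier w (σ : AddCircle (1 / (P : ℝ))) =
          ∑ p, segmentedBasis P φ σ p (a + w * P) * conj (segmentedBasis P φ σ p c) :=
      fun σ hσ ↦ by
        simp only [hb.segmentedBasis_add_mul hσ, Finset.sum_mul]
        exact Finset.sum_congr rfl fun p _ ↦ by ring
    rw [setIntegral_congr_fun measurableSet_Ico hshift, hφ.integral_sum_segmentedBasis_mul_conj,
      if_congr (natCast_add_mul_eq_natCast_iff a c w) rfl rfl, ite_and]
    simp [hP]
  filter_upwards [ae_eq_const_of_forall_integral_mul_fourier hint hcoeff] with σ hσ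
  simpa [Matrix.mul_apply, Matrix.one_apply, sampleMatrix] using hσ

lemma IsKLBasis.ae_basisMatrix_mem_unitaryGroup [NeZero P] (hφ : IsKLBasis μ x φ S)
    (hb : HasCSForm P φ b) : ∀ᵐ σ ∂volume.restrict (Ico (0 : ℝ) (1 / P)),
      basisMatrix P b σ ∈ Matrix.unitaryGroup (Fin P) ℂ := by
  filter_upwards [hφ.ae_sampleMatrix_mul_conjTranspose hb, ae_restrict_mem measurableSet_Ico]
    with σ h hσ using hb.basisMatrix_mem_unitaryGroup hσ h

end KLBasis

section Spectrum

variable {Ω : Type*} [MeasurableSpace Ω] {μ : Measure Ω} {x : ℤ → Ω → ℂ} {P : ℕ}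
  {φ : ℤ → ℝ → ℂ} {S : ℝ → ℂ} {b : Fin P → Fin P → ℝ → ℂ}

lemma continuous_cyclicSpectrum (hsum : ∀ n, Summable (autocorr μ x n)) (k : ℤ) :
    Continuous (cyclicSpectrum μ x P k) := by
  refine continuous_const.mul (continuous_finsetSum _ fun n _ ↦ ?_)
  refine continuous_tsum (fun m ↦ by fun_prop) (hsum n).norm fun m f ↦ ?_
  have hphase : -(Complex.I * (2 * Real.pi * ((k : ℂ) * n / P + f * m))) =
      ((-(2 * Real.pi * (k * n / P + f * m)) : ℝ) : ℂ) * Complex.I := by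
    push_cast
    ring
  rw [norm_mul, hphase, Complex.norm_exp_ofReal_mul_I, mul_one]

lemma continuous_cyclicPSDMatrix (hsum : ∀ n, Summable (autocorr μ x n)) :
    Continuous (cyclicPSDMatrix μ x P) :=
  continuous_matrix fun r c ↦
    (continuous_cyclicSpectrum hsum ((r : ℤ) - c)).comp (continuous_add_const ((r : ℝ) / P))

lemma IsKLBasis.aestronglyMeasurable_basisMatrix_apply [NeZero P] (hφ : IsKLBasis μ x φ S)
    (hb : HasCSForm P φ b) (q p : Fin P) :
    AEStronglyMeasurable (basisMatrix P b · q p) (volume.restrict (Ico (0 : ℝ) (1 / P))) := by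
  have hsample (a : Fin P) : AEStronglyMeasurable
      (fun σ ↦ conj (fourierMode P σ q a) * segmentedBasis P φ σ p a)
      (volume.restrict (Ico (0 : ℝ) (1 / P))) :=
    (Complex.continuous_conj.comp (continuous_fourierMode q a)).aestronglyMeasurable.mul
      (aestronglyMeasurable_restrict_Ico_zero_one_iff.1 (hφ.aestronglyMeasurable a) p)
  refine ((Finset.univ.aestronglyMeasurable_fun_sum fun a _ ↦ hsample a).const_mul
    (P : ℂ)⁻¹).congr ?_
  filter_upwards [ae_restrict_mem measurableSet_Ico] with σ hσ
  simp [hb.basisMatrix_eq hσ, Matrix.mul_apply, sampleMatrix]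

lemma IsKLBasis.aestronglyMeasurable_spectrum [NeZero P] (hφ : IsKLBasis μ x φ S)
    (hb : HasCSForm P φ b) (hcs : IsCyclostationary μ x P)
    (hsum : ∀ n, Summable (autocorr μ x n)) :
    AEStronglyMeasurable S (volume.restrict (Ico (0 : ℝ) 1)) := by
  have hB := hφ.aestronglyMeasurable_basisMatrix_apply hb
  have hX (r c : Fin P) : AEStronglyMeasurable (cyclicPSDMatrix μ x P · r c)
      (volume.restrict (Ico (0 : ℝ) (1 / P))) :=
    ((continuous_cyclicPSDMatrix hsum).matrix_elem r c).aestronglyMeasurable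
  refine (aestronglyMeasurable_restrict_Ico_zero_one_iff (P := P)).2 fun p ↦ ?_
  have hdiag : AEStronglyMeasurable
      (fun σ ↦ ∑ c, (∑ r, conj (basisMatrix P b σ r p) * cyclicPSDMatrix μ x P σ r c) *
        basisMatrix P b σ c p) (volume.restrict (Ico (0 : ℝ) (1 / P))) :=
    Finset.univ.aestronglyMeasurable_fun_sum fun c _ ↦
      (Finset.univ.aestronglyMeasurable_fun_sum fun r _ ↦
        (Complex.continuous_conj.comp_aestronglyMeasurable (hB r p)).mul (hX r c)).mul (hB c p)
  refine hdiag.congr ?_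
  filter_upwards [hφ.ae_basisMatrix_mem_unitaryGroup hb, ae_restrict_mem measurableSet_Ico]
    with σ hU hσ
  have h := star_mul_mul_eq_diagonal hU (hφ.cyclicPSDMatrix_mul_basisMatrix hb hcs hsum hσ)
  simpa [Matrix.mul_apply] using congrFun (congrFun h p) p

open scoped Matrix.Norms.L2Operator in
lemma IsKLBasis.memLp_spectrum [NeZero P] (hφ : IsKLBasis μ x φ S) (hb : HasCSForm P φ b)
    (hcs : IsCyclostationary μ x P) (hsum : ∀ n, Summable (autocorr μ x n)) :
    MemLp S 2 (volume.restrict (Ico (0 : ℝ) 1)) := by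
  obtain ⟨C, hC⟩ := (isCompact_Icc (a := (0 : ℝ)) (b := 1 / P)).exists_bound_of_continuousOn
    (continuous_cyclicPSDMatrix (P := P) hsum).continuousOn
  refine .of_bound (hφ.aestronglyMeasurable_spectrum hb hcs hsum) C
    ((ae_restrict_Ico_zero_one_iff (P := P)).2 fun p ↦ ?_)
  filter_upwards [hφ.ae_basisMatrix_mem_unitaryGroup hb, ae_restrict_mem measurableSet_Ico]
    with σ hU hσ
  exact (norm_le_of_mul_eq_mul_diagonal hU
    (hφ.cyclicPSDMatrix_mul_basisMatrix hb hcs hsum hσ) p).trans (hC σ (Ico_subset_Icc_self hσ))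

end Spectrum

section Hilbert

open scoped InnerProductSpace

variable {𝕜 H ι : Type*} [RCLike 𝕜] [NormedAddCommGroup H] [InnerProductSpace 𝕜 H]

lemma norm_sq_sum_smul_le_of_sum_norm_inner_le {X : ι → H} {C : ℝ}
    (hC : ∀ k (s : Finset ι), ∑ l ∈ s, ‖⟪X k, X l⟫_𝕜‖ ≤ C) (c : ι → 𝕜) (s : Finset ι) :
    ‖∑ n ∈ s, c n • X n‖ ^ 2 ≤ C * ∑ n ∈ s, ‖c n‖ ^ 2 := by
  have hrow : ∑ k ∈ s, ∑ l ∈ s, ‖c k‖ ^ 2 * ‖⟪X k, X l⟫_𝕜‖ ≤ C * ∑ n ∈ s, ‖c n‖ ^ 2 := by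
    rw [Finset.mul_sum]
    refine Finset.sum_le_sum fun k _ ↦ ?_
    rw [← Finset.mul_sum, mul_comm]
    gcongr
    exact hC k s
  have hcol : ∑ k ∈ s, ∑ l ∈ s, ‖c l‖ ^ 2 * ‖⟪X l, X k⟫_𝕜‖ ≤ C * ∑ n ∈ s, ‖c n‖ ^ 2 := by
    rwa [Finset.sum_comm]
  calc ‖∑ n ∈ s, c n • X n‖ ^ 2
      = ‖⟪∑ n ∈ s, c n • X n, ∑ n ∈ s, c n • X n⟫_𝕜‖ := by
        rw [inner_self_eq_norm_sq_to_K, norm_pow, RCLike.norm_ofReal, abs_norm]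
    _ ≤ ∑ k ∈ s, ∑ l ∈ s, ‖c k‖ * ‖c l‖ * ‖⟪X k, X l⟫_𝕜‖ := by
        rw [sum_inner]
        refine norm_sum_le_of_le _ fun k _ ↦ ?_
        rw [inner_sum]
        refine norm_sum_le_of_le _ fun l _ ↦ ?_
        simp [inner_smul_left, inner_smul_right, mul_assoc, mul_left_comm]
    _ ≤ ∑ k ∈ s, ∑ l ∈ s,
          (‖c k‖ ^ 2 * ‖⟪X k, X l⟫_𝕜‖ + ‖c l‖ ^ 2 * ‖⟪X l, X k⟫_𝕜‖) / 2 := by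
        gcongr with k _ l _
        rw [norm_inner_symm (X l) (X k), ← add_mul, mul_div_right_comm]
        gcongr
        linarith [two_mul_le_add_sq ‖c k‖ ‖c l‖]
    _ ≤ C * ∑ n ∈ s, ‖c n‖ ^ 2 := by
        simp only [← Finset.sum_div, Finset.sum_add_distrib]
        linarith

lemma summable_smul_of_sum_norm_inner_le [CompleteSpace H] {X : ι → H} {C : ℝ}
    (hC : ∀ k (s : Finset ι), ∑ l ∈ s, ‖⟪X k, X l⟫_𝕜‖ ≤ C) {c : ι → 𝕜}
    (hc : Summable fun n ↦ ‖c n‖ ^ 2) : Summable fun n ↦ c n • X n := by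
  rw [summable_iff_vanishing_norm]
  intro ε hε
  obtain ⟨s, hs⟩ := summable_iff_vanishing_norm.1 hc (ε ^ 2 / (|C| + 1)) (by positivity)
  refine ⟨s, fun t ht ↦ lt_of_pow_lt_pow_left₀ 2 hε.le ?_⟩
  have htail := hs t ht
  rw [Real.norm_of_nonneg (by positivity), lt_div_iff₀ (by positivity)] at htail
  calc ‖∑ n ∈ t, c n • X n‖ ^ 2
      ≤ C * ∑ n ∈ t, ‖c n‖ ^ 2 := norm_sq_sum_smul_le_of_sum_norm_inner_le hC c t
    _ ≤ (|C| + 1) * ∑ n ∈ t, ‖c n‖ ^ 2 := by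
        gcongr
        linarith [le_abs_self C]
    _ < ε ^ 2 := by rwa [mul_comm]

variable {v : ι → H}

lemma norm_sq_sum_inner_smul_sub (hv : Orthonormal 𝕜 v) (y : H) (s : Finset ι) :
    ‖∑ i ∈ s, ⟪v i, y⟫_𝕜 • v i - y‖ ^ 2 = ‖y‖ ^ 2 - ∑ i ∈ s, ‖⟪v i, y⟫_𝕜‖ ^ 2 := by
  have hself : ⟪∑ i ∈ s, ⟪v i, y⟫_𝕜 • v i, ∑ i ∈ s, ⟪v i, y⟫_𝕜 • v i⟫_𝕜 =
      ((∑ i ∈ s, ‖⟪v i, y⟫_𝕜‖ ^ 2 : ℝ) : 𝕜) := by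
    simp only [hv.inner_sum, RCLike.conj_mul, map_sum, RCLike.ofReal_pow]
  have hcross : ⟪∑ i ∈ s, ⟪v i, y⟫_𝕜 • v i, y⟫_𝕜 = ((∑ i ∈ s, ‖⟪v i, y⟫_𝕜‖ ^ 2 : ℝ) : 𝕜) := by
    simp only [sum_inner, inner_smul_left, RCLike.conj_mul, map_sum, RCLike.ofReal_pow]
  rw [norm_sub_sq (𝕜 := 𝕜), hcross, ← inner_self_eq_norm_sq (𝕜 := 𝕜), hself]
  simp only [RCLike.ofReal_re]
  ring

lemma hasSum_inner_smul_of_hasSum_norm_sq (hv : Orthonormal 𝕜 v) {y : H}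
    (hy : HasSum (fun i ↦ ‖⟪v i, y⟫_𝕜‖ ^ 2) (‖y‖ ^ 2)) :
    HasSum (fun i ↦ ⟪v i, y⟫_𝕜 • v i) y := by
  have hsq : Tendsto (fun s ↦ ‖∑ i ∈ s, ⟪v i, y⟫_𝕜 • v i - y‖ ^ 2)
      (SummationFilter.unconditional ι).filter (𝓝 0) := by
    simp only [norm_sq_sum_inner_smul_sub hv]
    rw [← sub_self (‖y‖ ^ 2)]
    exact tendsto_const_nhds.sub hy
  rw [HasSum, tendsto_iff_norm_sub_tendsto_zero]
  simpa using hsq.sqrt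

lemma hasSum_inner_mul_inner_of_hasSum_norm_sq (hv : Orthonormal 𝕜 v) {y : H}
    (hy : HasSum (fun i ↦ ‖⟪v i, y⟫_𝕜‖ ^ 2) (‖y‖ ^ 2)) (z : H) :
    HasSum (fun i ↦ ⟪z, v i⟫_𝕜 * ⟪v i, y⟫_𝕜) ⟪z, y⟫_𝕜 := by
  simpa [inner_smul_right, mul_comm] using
    (innerSL 𝕜 z).hasSum (hasSum_inner_smul_of_hasSum_norm_sq hv hy)

end Hilbert

section SquareIntegrable

variable {α 𝕜 : Type*} [RCLike 𝕜] [MeasurableSpace α] {ν : Measure α}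

lemma inner_toLp_toLp {f g : α → 𝕜} (hf : MemLp f 2 ν) (hg : MemLp g 2 ν) :
    inner 𝕜 (hf.toLp f) (hg.toLp g) = ∫ a, g a * conj (f a) ∂ν := by
  rw [L2.inner_def]
  refine integral_congr_ae ?_
  filter_upwards [hf.coeFn_toLp, hg.coeFn_toLp] with a hfa hga
  rw [hfa, hga, RCLike.inner_apply]

lemma inner_toLp_indicatorConstLp_one {f : α → 𝕜} (hf : MemLp f 2 ν) {A : Set α}
    (hA : MeasurableSet A) (hνA : ν A ≠ ⊤) :
    inner 𝕜 (hf.toLp f) (indicatorConstLp 2 hA hνA 1) = ∫ a in A, conj (f a) ∂ν := by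
  rw [← inner_conj_symm, L2.inner_indicatorConstLp_one, integral_conj]
  exact congrArg conj <| integral_congr_ae <| ae_restrict_of_ae hf.coeFn_toLp

lemma tendsto_eLpNorm_sum_sub_iff {ι κ : Type*} {l : Filter κ} {x : ι → α → 𝕜}
    (hx : ∀ n, MemLp (x n) 2 ν) (c : ι → 𝕜) (s : κ → Finset ι) {y : α → 𝕜} (hy : MemLp y 2 ν) :
    Tendsto (fun k ↦ eLpNorm (fun a ↦ (∑ n ∈ s k, x n a * c n) - y a) 2 ν) l (𝓝 0) ↔
      Tendsto (fun k ↦ ∑ n ∈ s k, c n • (hx n).toLp (x n)) l (𝓝 (hy.toLp y)) := by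
  have hmem (k : κ) : MemLp (fun a ↦ ∑ n ∈ s k, x n a * c n) 2 ν :=
    memLp_finsetSum _ fun n _ ↦ (hx n).mul_const (c n)
  have htoLp (k : κ) : (hmem k).toLp _ = ∑ n ∈ s k, c n • (hx n).toLp (x n) := by
    refine Lp.ext ((hmem k).coeFn_toLp.trans ?_)
    simp only [← MemLp.toLp_const_smul]
    have hcoe := (eventually_all_finset (s k)).2 fun n _ ↦ ((hx n).const_smul (c n)).coeFn_toLp
    filter_upwards [Lp.coeFn_fun_finsetSum (s k) fun n ↦ ((hx n).const_smul (c n)).toLp _,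
      hcoe] with a hsum hterm
    rw [hsum]
    exact Finset.sum_congr rfl fun n hn ↦ by simp [hterm n hn, mul_comm]
  have hiff := Lp.tendsto_Lp_iff_tendsto_eLpNorm'' (fi := l) _ hmem y hy
  simp only [htoLp] at hiff
  exact hiff.symm

end SquareIntegrable

section KLTransform

variable {Ω : Type*} [MeasurableSpace Ω] {μ : Measure Ω} {x : ℤ → Ω → ℂ} {P : ℕ}
  {φ : ℤ → ℝ → ℂ} {S : ℝ → ℂ} {b : Fin P → Fin P → ℝ → ℂ} {ξ : Set ℝ → Ω → ℂ} {A B : Set ℝ}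

lemma inner_toLp_eq_autocorr (hx : ∀ n, MemLp (x n) 2 μ) (k l : ℤ) :
    inner ℂ ((hx k).toLp (x k)) ((hx l).toLp (x l)) = autocorr μ x k (l - k) := by
  rw [inner_toLp_toLp, autocorr, add_sub_cancel]

lemma IsCyclostationary.exists_sum_norm_inner_toLp_le [NeZero P] (hcs : IsCyclostationary μ x P)
    (hsum : ∀ n, Summable (autocorr μ x n)) (hx : ∀ n, MemLp (x n) 2 μ) :
    ∃ C, ∀ k (s : Finset ℤ),
      ∑ l ∈ s, ‖inner ℂ ((hx k).toLp (x k)) ((hx l).toLp (x l))‖ ≤ C := by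
  have hper : Function.Periodic (fun k ↦ ∑' m, ‖autocorr μ x k m‖) P := fun k ↦
    tsum_congr fun m ↦ congrArg norm (hcs.periodic m k)
  obtain ⟨C, hC⟩ := bddAbove_range_of_periodic hper
  refine ⟨C, fun k s ↦ le_trans ?_ (hC (mem_range_self k))⟩
  simp only [inner_toLp_eq_autocorr]
  rw [← (Equiv.subRight k).tsum_eq]
  exact ((hsum k).norm.comp_injective sub_left_injective).sum_le_tsum s fun _ _ ↦ norm_nonneg _

lemma IsKLBasis.orthonormal_toLp (hφ : IsKLBasis μ x φ S) :
    Orthonormal ℂ fun n ↦ (hφ.memLp n).toLp (φ n) := by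
  rw [orthonormal_iff_ite]
  intro n n'
  rw [inner_toLp_toLp, hφ.orthonormal, if_congr eq_comm rfl rfl]

lemma IsKLBasis.hasSum_norm_sq_integral (hφ : IsKLBasis μ x φ S) (hA : MeasurableSet A)
    (hA1 : A ⊆ Ico 0 1) : HasSum (fun n ↦ ‖∫ t in A, conj (φ n t)‖ ^ 2) (volume.real A) := by
  rw [← Complex.hasSum_ofReal]
  have h := hφ.complete A A hA hA hA1 hA1
  simp only [integral_conj, Complex.mul_conj', inter_self] at h
  simpa [integral_conj] using h

lemma IsKLBasis.hasSum_integral_mul_integral_conj (hφ : IsKLBasis μ x φ S)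
    (hA : MeasurableSet A) (hA1 : A ⊆ Ico 0 1) {g : ℝ → ℂ}
    (hg : MemLp g 2 (volume.restrict (Ico (0 : ℝ) 1))) :
    HasSum (fun k ↦ (∫ t in Ico (0 : ℝ) 1, φ k t * g t) * ∫ t in A, conj (φ k t))
      (∫ t in A, g t) := by
  have hcoeff {f : ℝ → ℂ} (hf : MemLp f 2 (volume.restrict (Ico (0 : ℝ) 1))) :
      inner ℂ (hf.toLp f) (indicatorConstLp 2 hA (measure_ne_top _ A) 1) =
        ∫ t in A, conj (f t) := by
    rw [inner_toLp_indicatorConstLp_one, Measure.restrict_restrict_of_subset hA1]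
  have hnorm : ‖indicatorConstLp (μ := volume.restrict (Ico (0 : ℝ) 1)) 2 hA
      (measure_ne_top _ A) (1 : ℂ)‖ ^ 2 = volume.real A := by
    rw [← Complex.ofReal_inj, Complex.ofReal_pow, ← Complex.coe_algebraMap,
      ← inner_self_eq_norm_sq_to_K, L2.inner_indicatorConstLp_one_indicatorConstLp_one, inter_self,
      measureReal_restrict_apply hA, inter_eq_left.2 hA1]
  have hbessel := hφ.hasSum_norm_sq_integral hA hA1
  rw [← hnorm] at hbessel
  simp only [← hcoeff (hφ.memLp _)] at hbessel
  have hparseval := hasSum_inner_mul_inner_of_hasSum_norm_sq hφ.orthonormal_toLp hbessel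
    (hg.star.toLp (star g))
  simpa [hcoeff, inner_toLp_toLp] using hparseval

lemma IsKLBasis.integral_norm_le_one (hφ : IsKLBasis μ x φ S) (n : ℤ) :
    ∫ t in Ico (0 : ℝ) 1, ‖φ n t‖ ≤ 1 := by
  have hint := (hφ.memLp n).integrable one_le_two
  have hsq := (hφ.memLp n).integrable_norm_pow two_ne_zero
  have hone : ∫ t in Ico (0 : ℝ) 1, ‖φ n t‖ ^ 2 = 1 := by
    have h := hφ.orthonormal n n
    simp only [Complex.mul_conj', if_true] at h
    exact_mod_cast h
  have hle : ∫ t in Ico (0 : ℝ) 1, 2 * ‖φ n t‖ ≤ ∫ t in Ico (0 : ℝ) 1, (‖φ n t‖ ^ 2 + 1) :=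
    integral_mono (hint.norm.const_mul 2) (hsq.add (integrable_const 1)) fun t ↦ by
      simpa using two_mul_le_add_sq ‖φ n t‖ 1
  rw [integral_const_mul, integral_add hsq (integrable_const 1), hone] at hle
  norm_num at hle
  linarith

lemma IsKLBasis.hasSum_autocorr_mul_integral (hφ : IsKLBasis μ x φ S)
    (hsum : ∀ n, Summable (autocorr μ x n)) (hB : MeasurableSet B) (hB1 : B ⊆ Ico 0 1) (k : ℤ) :
    HasSum (fun l ↦ autocorr μ x l (k - l) * ∫ t in B, φ l t) (∫ t in B, φ k t * S t) := by
  have hint (l : ℤ) : IntegrableOn (φ l) (Ico (0 : ℝ) 1) := (hφ.memLp l).integrable one_le_two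
  have hle (l : ℤ) : ∫ t in B, ‖autocorr μ x l (k - l) * φ l t‖ ≤ ‖autocorr μ x l (k - l)‖ := by
    simp only [norm_mul]
    rw [integral_const_mul]
    refine mul_le_of_le_one_right (norm_nonneg _) (le_trans ?_ (hφ.integral_norm_le_one l))
    exact setIntegral_mono_set (hint l).norm (.of_forall fun _ ↦ norm_nonneg _) hB1.eventuallyLE
  have h := hasSum_integral_of_summable_integral_norm
    (fun l ↦ ((hint l).mono_set hB1).const_mul (autocorr μ x l (k - l)))
    ((summable_norm_autocorr_sub hsum k).of_nonneg_of_le (fun _ ↦ by positivity) hle)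
  rw [setIntegral_congr_fun hB fun t ht ↦ (hφ.eigenequation t (hB1 ht) k).tsum_eq] at h
  simpa only [integral_const_mul, mul_comm (S _)] using h

lemma IsKLBasis.summable_smul_toLp [NeZero P] (hφ : IsKLBasis μ x φ S)
    (hcs : IsCyclostationary μ x P) (hsum : ∀ n, Summable (autocorr μ x n))
    (hx : ∀ n, MemLp (x n) 2 μ) (hA : MeasurableSet A) (hA1 : A ⊆ Ico 0 1) :
    Summable fun n ↦ (∫ t in A, conj (φ n t)) • (hx n).toLp (x n) := by
  obtain ⟨C, hC⟩ := hcs.exists_sum_norm_inner_toLp_le hsum hx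
  exact summable_smul_of_sum_norm_inner_le hC (hφ.hasSum_norm_sq_integral hA hA1).summable

lemma tendsto_sum_Ico_neg_of_hasSum {M : Type*} [AddCommMonoid M] [TopologicalSpace M]
    {f : ℤ → M} {a : M} (h : HasSum f a) :
    Tendsto (fun N : ℕ ↦ ∑ n ∈ Finset.Ico (-(N : ℤ)) N, f n) atTop (𝓝 a) :=
  SummationFilter.hasSum_symmetricIco_int_iff.1 (h.mono_left SummationFilter.LeAtTop.le_atTop)

lemma IsKLBasis.exists_isKLTransform [NeZero P] (hφ : IsKLBasis μ x φ S)
    (hcs : IsCyclostationary μ x P) (hsum : ∀ n, Summable (autocorr μ x n))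
    (hx : ∀ n, MemLp (x n) 2 μ) : ∃ ξ : Set ℝ → Ω → ℂ, IsKLTransform μ x φ ξ := by
  refine ⟨fun A ↦ (∑' n, (∫ t in A, conj (φ n t)) • (hx n).toLp (x n) : Lp ℂ 2 μ),
    fun A hA hA1 ↦ ⟨Lp.memLp _, ?_⟩⟩
  rw [tendsto_eLpNorm_sum_sub_iff hx _ _ (Lp.memLp _), Lp.toLp_coeFn]
  exact tendsto_sum_Ico_neg_of_hasSum (hφ.summable_smul_toLp hcs hsum hx hA hA1).hasSum

lemma IsKLTransform.hasSum_toLp [NeZero P] (hξ : IsKLTransform μ x φ ξ)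
    (hφ : IsKLBasis μ x φ S) (hcs : IsCyclostationary μ x P)
    (hsum : ∀ n, Summable (autocorr μ x n)) (hx : ∀ n, MemLp (x n) 2 μ)
    (hA : MeasurableSet A) (hA1 : A ⊆ Ico 0 1) :
    HasSum (fun n ↦ (∫ t in A, conj (φ n t)) • (hx n).toLp (x n))
      ((hξ A hA hA1).1.toLp (ξ A)) := by
  obtain ⟨y, hy⟩ := hφ.summable_smul_toLp hcs hsum hx hA hA1
  have hlim := (tendsto_eLpNorm_sum_sub_iff hx _ _ (hξ A hA hA1).1).1 (hξ A hA hA1).2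
  rwa [tendsto_nhds_unique (tendsto_sum_Ico_neg_of_hasSum hy) hlim] at hy

lemma IsKLTransform.inner_toLp [NeZero P] (hξ : IsKLTransform μ x φ ξ)
    (hφ : IsKLBasis μ x φ S) (hcs : IsCyclostationary μ x P)
    (hsum : ∀ n, Summable (autocorr μ x n)) (hx : ∀ n, MemLp (x n) 2 μ)
    (hA : MeasurableSet A) (hA1 : A ⊆ Ico 0 1) (k : ℤ) :
    inner ℂ ((hξ A hA hA1).1.toLp (ξ A)) ((hx k).toLp (x k)) = ∫ t in A, φ k t * S t := by
  have hconj := (innerSL ℂ ((hx k).toLp (x k))).hasSum (hξ.hasSum_toLp hφ hcs hsum hx hA hA1)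
  have hinner := hconj.map (starRingEnd ℂ) Complex.continuous_conj
  have hcorr := hφ.hasSum_autocorr_mul_integral hsum hA hA1 k
  simp only [Function.comp_def, innerSL_apply_apply, inner_smul_right, map_mul, inner_conj_symm,
    ← integral_conj, Complex.conj_conj, mul_comm (∫ _ in A, _)] at hinner
  simp only [inner_toLp_eq_autocorr] at hinner
  exact hinner.unique hcorr

lemma IsKLTransform.integral_mul_conj [NeZero P] (hξ : IsKLTransform μ x φ ξ)
    (hφ : IsKLBasis μ x φ S) (hb : HasCSForm P φ b) (hcs : IsCyclostationary μ x P)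
    (hsum : ∀ n, Summable (autocorr μ x n)) (hx : ∀ n, MemLp (x n) 2 μ)
    (hA : MeasurableSet A) (hA1 : A ⊆ Ico 0 1) (hB : MeasurableSet B) (hB1 : B ⊆ Ico 0 1) :
    ∫ ω, ξ A ω * conj (ξ B ω) ∂μ = ∫ t in A ∩ B, S t := by
  have hcross (k : ℤ) : inner ℂ ((hξ B hB hB1).1.toLp (ξ B)) ((hx k).toLp (x k)) =
      ∫ t in Ico (0 : ℝ) 1, φ k t * B.indicator S t := by
    rw [hξ.inner_toLp hφ hcs hsum hx hB hB1, ← Measure.restrict_restrict_of_subset hB1,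
      ← integral_indicator hB]
    simp only [indicator_mul_right]
  have hexp := (innerSL ℂ ((hξ B hB hB1).1.toLp (ξ B))).hasSum
    (hξ.hasSum_toLp hφ hcs hsum hx hA hA1)
  simp only [innerSL_apply_apply, inner_smul_right, hcross, inner_toLp_toLp,
    mul_comm (∫ _ in A, _)] at hexp
  have hparseval := hφ.hasSum_integral_mul_integral_conj hA hA1
    ((hφ.memLp_spectrum hb hcs hsum).indicator hB)
  rw [hexp.unique hparseval, setIntegral_indicator hB]

lemma IsKLTransform.integral_klVector_mul_conj (hξ : IsKLTransform μ x φ ξ)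
    (hφ : IsKLBasis μ x φ S) (hb : HasCSForm P φ b) (hcs : IsCyclostationary μ x P)
    (hsum : ∀ n, Summable (autocorr μ x n)) (hx : ∀ n, MemLp (x n) 2 μ)
    (hA : MeasurableSet A) (hB : MeasurableSet B) (hA1 : A ⊆ Ico 0 (1 / P))
    (hB1 : B ⊆ Ico 0 (1 / P)) (p q : Fin P) :
    ∫ ω, klVector P ξ A ω p * conj (klVector P ξ B ω q) ∂μ =
      ∫ σ in A ∩ B, klPSDMatrix P S σ p q := by
  have : NeZero P := ⟨p.pos.ne'⟩
  have hemb (p : Fin P) : MeasurableEmbedding fun σ : ℝ ↦ σ + (p : ℝ) / P :=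
    measurableEmbedding_addRight _
  simp only [klVector]
  rw [hξ.integral_mul_conj hφ hb hcs hsum hx
    ((hemb p).measurableSet_image.2 hA) (image_add_div_subset hA1 p)
    ((hemb q).measurableSet_image.2 hB) (image_add_div_subset hB1 q)]
  rcases eq_or_ne p q with rfl | hpq
  · rw [← image_inter (hemb p).injective,
      (measurePreserving_add_right volume ((p : ℝ) / P)).setIntegral_image_emb (hemb p)]
    simp [klPSDMatrix]
  · rw [(disjoint_image_add_div hA1 hB1 hpq).inter_eq]
    simp [klPSDMatrix, hpq]

end KLTransform

section Power

variable {Ω : Type*} [MeasurableSpace Ω] {μ : Measure Ω} {x : ℤ → Ω → ℂ} {P : ℕ}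

lemma autocorr_zero_right (n : ℤ) :
    autocorr μ x n 0 = ((∫ ω, ‖x n ω‖ ^ 2 ∂μ : ℝ) : ℂ) := by
  simp only [autocorr, add_zero, Complex.mul_conj', ← Complex.ofReal_pow, integral_complex_ofReal]

lemma IsCyclostationary.hasAveragePower [NeZero P] (hcs : IsCyclostationary μ x P) :
    HasAveragePower μ x ((1 / (P : ℝ)) * ∑ n ∈ Finset.range P, ∫ ω, ‖x n ω‖ ^ 2 ∂μ) :=
  tendsto_average_Ico_of_periodic (a := fun n ↦ ∫ ω, ‖x n ω‖ ^ 2 ∂μ) fun n ↦ by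
    simpa [autocorr_zero_right] using hcs.periodic 0 n

lemma cyclicSpectrum_zero_eq_tsum (hsum : ∀ n, Summable (autocorr μ x n)) (f : ℝ) :
    cyclicSpectrum μ x P 0 f =
      ∑' m, (1 / (P : ℂ) * ∑ n ∈ Finset.range P, autocorr μ x n m) *
        fourier (-m) (f : UnitAddCircle) := by
  have hterm (n : ℕ) (m : ℤ) : autocorr μ x n m *
      Complex.exp (-(Complex.I * (2 * Real.pi * (((0 : ℤ) : ℂ) * n / P + f * m)))) =
        autocorr μ x n m * fourier (-m) (f : UnitAddCircle) := by
    rw [fourier_coe_apply]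
    congr 2
    push_cast
    ring
  have hsumm (n : ℕ) : Summable fun m ↦ autocorr μ x n m * fourier (-m) (f : UnitAddCircle) :=
    .of_norm <| by simpa only [norm_mul_fourier] using (hsum n).norm
  simp only [cyclicSpectrum, hterm]
  simp only [mul_assoc, tsum_mul_left, Finset.sum_mul]
  rw [Summable.tsum_finsetSum fun n _ ↦ hsumm n]

lemma integral_cyclicSpectrum_zero (hsum : ∀ n, Summable (autocorr μ x n)) :
    ∫ f in Ico (0 : ℝ) 1, cyclicSpectrum μ x P 0 f =
      1 / (P : ℂ) * ∑ n ∈ Finset.range P, autocorr μ x n 0 := by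
  have hcoeff : Summable fun m ↦ 1 / (P : ℂ) * ∑ n ∈ Finset.range P, autocorr μ x n m :=
    (summable_sum fun (n : ℕ) _ ↦ hsum n).mul_left _
  simp only [cyclicSpectrum_zero_eq_tsum hsum, integral_Ico_tsum_mul_fourier_neg hcoeff,
    Complex.ofReal_one, one_mul]

lemma trace_cyclicPSDMatrix (σ : ℝ) : (cyclicPSDMatrix μ x P σ).trace =
    ∑ r : Fin P, cyclicSpectrum μ x P 0 (σ + (r : ℝ) / P) := by
  simp [Matrix.trace, cyclicPSDMatrix]

lemma integrableOn_trace_cyclicPSDMatrix (hsum : ∀ n, Summable (autocorr μ x n)) :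
    IntegrableOn (fun σ ↦ (cyclicPSDMatrix μ x P σ).trace) (Ico (0 : ℝ) (1 / P)) :=
  (continuous_cyclicPSDMatrix hsum).matrix_trace.integrableOn_Icc.mono_set Ico_subset_Icc_self

lemma integral_trace_cyclicPSDMatrix [NeZero P] (hsum : ∀ n, Summable (autocorr μ x n)) :
    ∫ σ in Ico (0 : ℝ) (1 / P), (cyclicPSDMatrix μ x P σ).trace =
      (((1 / (P : ℝ)) * ∑ n ∈ Finset.range P, ∫ ω, ‖x n ω‖ ^ 2 ∂μ : ℝ) : ℂ) := by
  have hint : IntegrableOn (cyclicSpectrum μ x P 0) (Ico (0 : ℝ) 1) :=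
    (continuous_cyclicSpectrum hsum 0).integrableOn_Icc.mono_set Ico_subset_Icc_self
  simp only [trace_cyclicPSDMatrix]
  rw [← integral_Ico_zero_one_eq_integral_sum hint, integral_cyclicSpectrum_zero hsum]
  simp only [autocorr_zero_right]
  push_cast
  rfl

lemma IsCyclostationary.exists_hasAveragePower_eq_integral_trace [NeZero P]
    (hcs : IsCyclostationary μ x P) (hsum : ∀ n, Summable (autocorr μ x n)) :
    ∃ power : ℝ, HasAveragePower μ x power ∧
      (power : ℂ) = ∫ σ in Ico (0 : ℝ) (1 / P), (cyclicPSDMatrix μ x P σ).trace :=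
  ⟨_, hcs.hasAveragePower, (integral_trace_cyclicPSDMatrix hsum).symm⟩

end Power

section KLPSDMatrix

variable {Ω : Type*} [MeasurableSpace Ω] {μ : Measure Ω} {x : ℤ → Ω → ℂ} {P : ℕ}
  {φ : ℤ → ℝ → ℂ} {S : ℝ → ℂ} {b : Fin P → Fin P → ℝ → ℂ}

lemma IsKLBasis.roots_charpoly_cyclicPSDMatrix [NeZero P] (hφ : IsKLBasis μ x φ S)
    (hb : HasCSForm P φ b) (hcs : IsCyclostationary μ x P)
    (hsum : ∀ n, Summable (autocorr μ x n)) {σ : ℝ} (hσ : σ ∈ Ico (0 : ℝ) (1 / P))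
    (hU : basisMatrix P b σ ∈ Matrix.unitaryGroup (Fin P) ℂ) :
    (cyclicPSDMatrix μ x P σ).charpoly.roots =
      Finset.univ.val.map (fun p : Fin P ↦ klPSDMatrix P S σ p p) := by
  rw [roots_charpoly_of_mul_eq_mul_diagonal hU
    (hφ.cyclicPSDMatrix_mul_basisMatrix hb hcs hsum hσ)]
  simp only [klPSDMatrix, Matrix.diagonal_apply_eq]

lemma IsKLBasis.integrableOn_klPSDMatrix_apply (hφ : IsKLBasis μ x φ S) (hb : HasCSForm P φ b)
    (hcs : IsCyclostationary μ x P) (hsum : ∀ n, Summable (autocorr μ x n)) (p q : Fin P) :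
    IntegrableOn (fun σ ↦ klPSDMatrix P S σ p q) (Ico (0 : ℝ) (1 / P)) := by
  have : NeZero P := ⟨p.pos.ne'⟩
  rcases eq_or_ne p q with rfl | hpq
  · simpa only [klPSDMatrix, Matrix.diagonal_apply_eq] using
      integrableOn_Ico_zero_one_iff.1
        ((hφ.memLp_spectrum hb hcs hsum).integrable one_le_two) p
  · simp [klPSDMatrix, hpq]

lemma IsKLBasis.integral_trace_cyclicPSDMatrix [NeZero P] (hφ : IsKLBasis μ x φ S)
    (hb : HasCSForm P φ b) (hcs : IsCyclostationary μ x P)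
    (hsum : ∀ n, Summable (autocorr μ x n)) :
    ∫ σ in Ico (0 : ℝ) (1 / P), (cyclicPSDMatrix μ x P σ).trace =
      ∫ σ in Ico (0 : ℝ) (1 / P), (klPSDMatrix P S σ).trace := by
  refine integral_congr_ae ?_
  filter_upwards [hφ.ae_basisMatrix_mem_unitaryGroup hb, ae_restrict_mem measurableSet_Ico]
    with σ hU hσ
  exact trace_eq_of_mul_eq_mul_diagonal hU (hφ.cyclicPSDMatrix_mul_basisMatrix hb hcs hsum hσ)

end KLPSDMatrix

theorem corollary2_general {Ω : Type*} [MeasurableSpace Ω] (μ : Measure Ω)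
    (P : ℕ) (hP : 0 < P) (x : ℤ → Ω → ℂ)
    (hx : ∀ n, MemLp (x n) 2 μ)
    (hcs : IsCyclostationary μ x P)
    (hsum : ∀ n : ℤ, Summable fun m : ℤ => autocorr μ x n m) :
    (∀ (φ : ℤ → ℝ → ℂ) (S : ℝ → ℂ) (b : Fin P → Fin P → ℝ → ℂ),
      IsKLBasis μ x φ S → HasCSForm P φ b →
      (∀ᵐ σ ∂(volume.restrict (Ico (0 : ℝ) (1 / P))),
        basisMatrix P b σ ∈ Matrix.unitaryGroup (Fin P) ℂ) ∧
      (∀ σ ∈ Ico (0 : ℝ) (1 / P), basisMatrix P b σ ∈ Matrix.unitaryGroup (Fin P) ℂ →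
        (cyclicPSDMatrix μ x P σ).charpoly.roots =
          Finset.univ.val.map (fun p : Fin P => klPSDMatrix P S σ p p)) ∧
      (∃ ξ : Set ℝ → Ω → ℂ, IsKLTransform μ x φ ξ) ∧
      (∀ p q : Fin P, IntegrableOn (fun σ => klPSDMatrix P S σ p q) (Ico (0 : ℝ) (1 / P))) ∧
      (∀ ξ : Set ℝ → Ω → ℂ, IsKLTransform μ x φ ξ →
        ∀ A B : Set ℝ, MeasurableSet A → MeasurableSet B →
          A ⊆ Ico (0 : ℝ) (1 / P) → B ⊆ Ico (0 : ℝ) (1 / P) →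
          ∀ p q : Fin P,
            ∫ ω, klVector P ξ A ω p * conj (klVector P ξ B ω q) ∂μ =
              ∫ σ in A ∩ B, klPSDMatrix P S σ p q) ∧
      ∃ power : ℝ, HasAveragePower μ x power ∧
        (power : ℂ) = ∫ σ in Ico (0 : ℝ) (1 / P), (klPSDMatrix P S σ).trace) ∧
    IntegrableOn (fun σ => (cyclicPSDMatrix μ x P σ).trace) (Ico (0 : ℝ) (1 / P)) ∧
    ∃ power : ℝ, HasAveragePower μ x power ∧
      (power : ℂ) = ∫ σ in Ico (0 : ℝ) (1 / P), (cyclicPSDMatrix μ x P σ).trace := by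
  have : NeZero P := ⟨hP.ne'⟩
  refine ⟨fun φ S b hφ hb ↦ ?_, integrableOn_trace_cyclicPSDMatrix hsum,
    hcs.exists_hasAveragePower_eq_integral_trace hsum⟩
  refine ⟨hφ.ae_basisMatrix_mem_unitaryGroup hb, ?eigenvalues, hφ.exists_isKLTransform hcs hsum hx,
    hφ.integrableOn_klPSDMatrix_apply hb hcs hsum, ?correlation, ?power⟩
  case eigenvalues =>
    exact fun σ hσ hU ↦ hφ.roots_charpoly_cyclicPSDMatrix hb hcs hsum hσ hU
  case correlation =>
    exact fun ξ hξ A B hA hB hA1 hB1 p q ↦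
      hξ.integral_klVector_mul_conj hφ hb hcs hsum hx hA hB hA1 hB1 p q
  case power =>
    rw [← hφ.integral_trace_cyclicPSDMatrix hb hcs hsum]
    exact hcs.exists_hasAveragePower_eq_integral_trace hsum

theorem corollary2 {Ω : Type*} [MeasurableSpace Ω] (μ : Measure Ω) [IsProbabilityMeasure μ]
    (P : ℕ) (hP : 0 < P) (x : ℤ → Ω → ℂ)
    (hx : ∀ n, MemLp (x n) 2 μ)
    (hcs : IsCyclostationary μ x P)
    (hsum : ∀ n : ℤ, Summable fun m : ℤ => autocorr μ x n m) :
    -- the KL-PSD matrix, for every KL basis of cyclostationary form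
    (∀ (φ : ℤ → ℝ → ℂ) (S : ℝ → ℂ) (b : Fin P → Fin P → ℝ → ℂ),
      IsKLBasis μ x φ S → HasCSForm P φ b →
      -- the basis matrix is unitary for almost all `σ`; wherever it is, the diagonal of the
      -- KL-PSD matrix is the list of the `P` eigenvalues of the cyclic PSD matrix
      (∀ᵐ σ ∂(volume.restrict (Ico (0 : ℝ) (1 / P))),
        basisMatrix P b σ ∈ Matrix.unitaryGroup (Fin P) ℂ) ∧
      (∀ σ ∈ Ico (0 : ℝ) (1 / P), basisMatrix P b σ ∈ Matrix.unitaryGroup (Fin P) ℂ →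
        (cyclicPSDMatrix μ x P σ).charpoly.roots =
          Finset.univ.val.map (fun p : Fin P => klPSDMatrix P S σ p p)) ∧
      -- the KL transform exists, and `E[x̃ x̃ᴴ]` has the KL-PSD matrix as its density
      (∃ ξ : Set ℝ → Ω → ℂ, IsKLTransform μ x φ ξ) ∧
      (∀ p q : Fin P, IntegrableOn (fun σ => klPSDMatrix P S σ p q) (Ico (0 : ℝ) (1 / P))) ∧
      (∀ ξ : Set ℝ → Ω → ℂ, IsKLTransform μ x φ ξ →
        ∀ A B : Set ℝ, MeasurableSet A → MeasurableSet B →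
          A ⊆ Ico (0 : ℝ) (1 / P) → B ⊆ Ico (0 : ℝ) (1 / P) →
          ∀ p q : Fin P,
            ∫ ω, klVector P ξ A ω p * conj (klVector P ξ B ω q) ∂μ =
              ∫ σ in A ∩ B, klPSDMatrix P S σ p q) ∧
      ∃ power : ℝ, HasAveragePower μ x power ∧
        (power : ℂ) = ∫ σ in Ico (0 : ℝ) (1 / P), (klPSDMatrix P S σ).trace) ∧
    -- the power of the process
    IntegrableOn (fun σ => (cyclicPSDMatrix μ x P σ).trace) (Ico (0 : ℝ) (1 / P)) ∧
    ∃ power : ℝ, HasAveragePower μ x power ∧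
      (power : ℂ) = ∫ σ in Ico (0 : ℝ) (1 / P), (cyclicPSDMatrix μ x P σ).trace :=
  corollary2_general μ P hP x hx hcs hsum
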